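/- **Theorem (Painlevé V for $R_n$).** Let $\alpha>0$, $\gamma>0$, and let $A,B$ be real constants with $A\ge 0$, $A+B\ge 0$, not both $A$ and $A+B$ equal to $0$. For $t>0$ and $x\ge 0$ put $$w(x,t)=x^{\alpha}\mathrm{e}^{-x}|x-t|^{\gamma}\bigl(A+B\,\theta(x-t)\bigr),$$ where $\theta(x)=1$ for $x>0$ and $\theta(x)=0$ otherwise. Let $P_n(x,t)$ $(n=0,1,2,\dots)$ be the monic polynomials of degree $n$ in $x$ that are orthogonal with respect to $w(\cdot,t)$ on $[0,\infty)$, and let $$h_n(t)=\int_0^\infty P_n^2(y,t)\,w(y,t)\,dy,\qquad R_n(t)=\frac{\gamma}{h_n(t)}\int_0^\infty\frac{P_n^2(y,t)}{y-t}\,w(y,t)\,dy .$$ Then for every integer $n\ge 0$: 1. $R_n$ is twice differentiable on $(0,\infty)$, and for all $t>0$ $$\begin{aligned}&2t^2R_n(1-R_n)R_n''-t^2(1-2R_n)(R_n')^2+2tR_n(1-R_n)R_n'+2t^2R_n^5+t(4n+2+2\alpha+2\gamma-5t)R_n^4\\&\quad-4t(2n+1+\alpha+\gamma-t)R_n^3-\bigl[t^2-2(2n+1+\alpha+\gamma)t+\alpha^2-\gamma^2\bigr]R_n^2-2\gamma^2R_n+\gamma^2=0.\end{aligned}$$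 2. $R_n(t)\neq 1$ for all $t>0$, the function $S_n(t)=\dfrac{R_n(t)}{R_n(t)-1}$ is twice differentiable on $(0,\infty)$, and at every $t>0$ with $R_n(t)\ne 0$ (equivalently $S_n(t)\neq 0$) $$S_n''=\frac{(3S_n-1)(S_n')^2}{2S_n(S_n-1)}-\frac{S_n'}{t}+\frac{(S_n-1)^2}{t^2}\left(\frac{\alpha^2S_n}{2}-\frac{\gamma^2}{2S_n}\right)-\frac{(2n+1+\alpha+\gamma)S_n}{t}-\frac{S_n(S_n+1)}{2(S_n-1)}.$$ That is, $S_n$ satisfies there the Painlevé V equation $P_V(a,b,c,d)$, $$y''=\left(\frac1{2y}+\frac1{y-1}\right)(y')^2-\frac{y'}{t}+\frac{(y-1)^2}{t^2}\left(ay+\frac by\right)+\frac{cy}{t}+\frac{d\,y(y+1)}{y-1},$$ with parameters $(a,b,c,d)=\left(\frac{\alpha^2}{2},-\frac{\gamma^2}{2},-(2n+1+\alpha+\gamma),-\frac12\right)$. -/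

import Mathlib

open MeasureTheory Set

noncomputable section

namespace PerturbedLaguerre

/-- The Heaviside step function: `1` for `x > 0` and `0` otherwise. -/
def heaviside (x : ℝ) : ℝ := if 0 < x then 1 else 0

/-- The weight `w(x, t) = x ^ α * e ^ (-x) * |x - t| ^ γ * (A + B θ(x - t))`. -/
def weight (α γ A B t x : ℝ) : ℝ :=
  x ^ α * Real.exp (-x) * |x - t| ^ γ * (A + B * heaviside (x - t))

/-- The pairing `∫₀^∞ p(x) q(x) w(x) dx` of two real polynomials. -/
def pairing (w : ℝ → ℝ) (p q : Polynomial ℝ) : ℝ :=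
  ∫ x in Ioi (0 : ℝ), p.eval x * q.eval x * w x

/-- The monic orthogonal polynomials of a weight `w` on `[0, ∞)`, by the Gram–Schmidt process
applied to the monomials.  For the weight above, `monicOP_monic`, `natDegree_monicOP` and
`pairing_monicOP_of_ne` below show that they are the monic polynomials of degree `n`
that are orthogonal with respect to `w`. -/
def monicOP (w : ℝ → ℝ) (n : ℕ) : Polynomial ℝ :=
  Polynomial.X ^ n - ∑ k : Fin n,
    Polynomial.C (pairing w (Polynomial.X ^ n) (monicOP w k) /
      pairing w (monicOP w k) (monicOP w k)) * monicOP w k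
termination_by n
decreasing_by all_goals exact k.2

/-- `P_n(·, t)`. -/
def P (α γ A B : ℝ) (n : ℕ) (t : ℝ) : Polynomial ℝ := monicOP (weight α γ A B t) n

/-- `h_n(t) = ∫₀^∞ P_n(y, t)² w(y, t) dy`. -/
def h (α γ A B : ℝ) (n : ℕ) (t : ℝ) : ℝ :=
  ∫ y in Ioi (0 : ℝ), (P α γ A B n t).eval y ^ 2 * weight α γ A B t y

/-- `R_n(t) = (γ / h_n(t)) ∫₀^∞ P_n(y, t)² w(y, t) / (y - t) dy`. -/
def R (α γ A B : ℝ) (n : ℕ) (t : ℝ) : ℝ :=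
  γ / h α γ A B n t *
    ∫ y in Ioi (0 : ℝ), (P α γ A B n t).eval y ^ 2 / (y - t) * weight α γ A B t y

/-- `S_n(t) = R_n(t) / (R_n(t) - 1)`. -/
def S (α γ A B : ℝ) (n : ℕ) (t : ℝ) : ℝ := R α γ A B n t / (R α γ A B n t - 1)

/-- `y` satisfies the fifth Painlevé equation `P_V(a, b, c, d)`,
`y'' = (1/(2y) + 1/(y-1)) y'² - y'/t + ((y-1)²/t²) (a y + b/y) + c y/t + d y (y+1)/(y-1)`,
at the point `t`: `y` is twice differentiable there, no denominator vanishes, and the equation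
holds. -/
def PainleveVAt (a b c d : ℝ) (y : ℝ → ℝ) (t : ℝ) : Prop :=
  (∀ᶠ s in nhds t, DifferentiableAt ℝ y s) ∧ DifferentiableAt ℝ (deriv y) t ∧
  t ≠ 0 ∧ y t ≠ 0 ∧ y t ≠ 1 ∧
  deriv (deriv y) t =
    (1 / (2 * y t) + 1 / (y t - 1)) * deriv y t ^ 2 - deriv y t / t
      + (y t - 1) ^ 2 / t ^ 2 * (a * y t + b / y t) + c * y t / t
      + d * y t * (y t + 1) / (y t - 1)

/-! ### The polynomials are well defined -/

theorem degree_sum_lt (w : ℝ → ℝ) (n : ℕ)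
    (hk : ∀ k < n, (monicOP w k).degree = (k : WithBot ℕ)) :
    (∑ k : Fin n, Polynomial.C (pairing w (Polynomial.X ^ n) (monicOP w k) /
      pairing w (monicOP w k) (monicOP w k)) * monicOP w k).degree < (n : WithBot ℕ) := by
  refine (Polynomial.degree_sum_le _ _).trans_lt ?_
  rw [Finset.sup_lt_iff (by exact_mod_cast WithBot.bot_lt_coe n)]
  intro k _
  rw [← Polynomial.smul_eq_C_mul]
  refine (Polynomial.degree_smul_le _ _).trans_lt ?_
  rw [hk k k.2]
  exact_mod_cast k.2

theorem degree_monicOP (w : ℝ → ℝ) (n : ℕ) : (monicOP w n).degree = (n : WithBot ℕ) := by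
  induction n using Nat.strong_induction_on with
  | _ n ih =>
    rw [monicOP, Polynomial.degree_sub_eq_left_of_degree_lt, Polynomial.degree_X_pow]
    rw [Polynomial.degree_X_pow]
    exact degree_sum_lt w n ih

theorem natDegree_monicOP (w : ℝ → ℝ) (n : ℕ) : (monicOP w n).natDegree = n :=
  Polynomial.natDegree_eq_of_degree_eq_some (degree_monicOP w n)

theorem monicOP_monic (w : ℝ → ℝ) (n : ℕ) : (monicOP w n).Monic := by
  rw [monicOP]
  refine (Polynomial.monic_X_pow n).sub_of_left ?_
  rw [Polynomial.degree_X_pow]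
  exact degree_sum_lt w n fun k _ => degree_monicOP w k

theorem integrableOn_poly (α : ℝ) (hα : 0 < α) (p : Polynomial ℝ) :
    IntegrableOn (fun x : ℝ => p.eval x * (x ^ α * Real.exp (-x))) (Ioi 0) := by
  induction p using Polynomial.induction_on' with
  | add p q hp hq =>
    refine (hp.add hq).congr (ae_of_all _ fun x => ?_)
    simp [add_mul]
  | monomial n a =>
    have h1 := (Real.GammaIntegral_convergent (s := n + α + 1) (by positivity)).const_mul a
    refine IntegrableOn.congr_fun h1 (fun x hx => ?_) measurableSet_Ioi
    have hx' : (0 : ℝ) < x := hx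
    simp only [Polynomial.eval_monomial]
    rw [show (n : ℝ) + α + 1 - 1 = n + α by ring, Real.rpow_add hx', Real.rpow_natCast]
    ring

theorem integrableOn_weight {α γ A B : ℝ} (hα : 0 < α) (hγ : 0 < γ) (t : ℝ)
    (p : Polynomial ℝ) :
    IntegrableOn (fun x : ℝ => p.eval x * weight α γ A B t x) (Ioi 0) := by
  obtain ⟨N, hN⟩ := exists_nat_ge γ
  set q : Polynomial ℝ := (Polynomial.X + Polynomial.C (1 + |t|)) ^ N with hq
  have hI := (integrableOn_poly α hα (p * q)).norm.const_mul (|A| + |B|)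
  refine Integrable.mono' hI ?_ ?_
  · refine (Measurable.mul p.continuous.measurable ?_).aestronglyMeasurable
    unfold weight heaviside
    refine Measurable.mul (by fun_prop) (measurable_const.add (measurable_const.mul ?_))
    exact Measurable.ite (measurableSet_lt measurable_const (by fun_prop))
      measurable_const measurable_const
  · refine (ae_restrict_iff' measurableSet_Ioi).2 (ae_of_all _ fun x hx => ?_)
    have hx' : (0 : ℝ) < x := hx
    have e1 : |x - t| ≤ x + |t| := (abs_sub x t).trans (by rw [abs_of_pos hx'])
    have e2 : |x - t| ^ γ ≤ (x + (1 + |t|)) ^ N := by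
      have : 0 ≤ |t| := abs_nonneg t
      calc |x - t| ^ γ ≤ (x + (1 + |t|)) ^ γ :=
            Real.rpow_le_rpow (abs_nonneg _) (by linarith) hγ.le
        _ ≤ (x + (1 + |t|)) ^ (N : ℝ) := Real.rpow_le_rpow_of_exponent_le (by linarith) hN
        _ = _ := Real.rpow_natCast _ _
    have e3 : |A + B * heaviside (x - t)| ≤ |A| + |B| := by
      refine (abs_add_le _ _).trans ?_
      unfold heaviside
      split_ifs <;> simp
    have e4 : 0 ≤ x ^ α * Real.exp (-x) := by positivity
    have e5 : 0 ≤ (x + (1 + |t|)) ^ N := by positivity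
    simp only [weight, Real.norm_eq_abs, abs_mul, hq, Polynomial.eval_mul, Polynomial.eval_pow,
      Polynomial.eval_add, Polynomial.eval_X, Polynomial.eval_C, abs_of_nonneg e5,
      abs_of_nonneg (Real.rpow_nonneg (abs_nonneg (x - t)) γ)]
    calc _ = (|p.eval x| * (|x ^ α| * |Real.exp (-x)|)) *
          (|x - t| ^ γ * |A + B * heaviside (x - t)|) := by ring
      _ ≤ (|p.eval x| * (|x ^ α| * |Real.exp (-x)|)) *
          ((x + (1 + |t|)) ^ N * (|A| + |B|)) := by gcongr
      _ = _ := by ring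

theorem weight_nonneg {α γ A B t x : ℝ} (hA : 0 ≤ A) (hAB : 0 ≤ A + B) (hx : 0 < x) :
    0 ≤ weight α γ A B t x := by
  have : 0 ≤ A + B * heaviside (x - t) := by unfold heaviside; split_ifs <;> simpa
  unfold weight
  positivity

theorem pairing_self_pos {α γ A B t : ℝ} (hα : 0 < α) (hγ : 0 < γ) (hA : 0 ≤ A)
    (hAB : 0 ≤ A + B) (h0 : A ≠ 0 ∨ A + B ≠ 0) (ht : 0 < t) {p : Polynomial ℝ} (hp : p ≠ 0) :
    0 < pairing (weight α γ A B t) p p := by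
  have hI := integrableOn_weight (A := A) (B := B) hα hγ t (p * p)
  simp only [Polynomial.eval_mul] at hI
  unfold pairing
  rw [setIntegral_pos_iff_support_of_nonneg_ae _ hI]
  · have key : ∃ a b : ℝ, 0 ≤ a ∧ a < b ∧ ∀ x ∈ Ioo a b, weight α γ A B t x ≠ 0 := by
      rcases h0 with h | h
      · refine ⟨0, t, le_rfl, ht, fun x hx => ?_⟩
        have h1 : ¬ 0 < x - t := by linarith [hx.2]
        have h2 : |x - t| ≠ 0 := abs_ne_zero.2 (by linarith [hx.2] : x - t < 0).ne
        simp only [weight, heaviside, h1, if_false, mul_zero, add_zero]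
        have := (Real.rpow_pos_of_pos hx.1 α).ne'
        have := (Real.rpow_pos_of_pos (lt_of_le_of_ne (abs_nonneg _) h2.symm) γ).ne'
        positivity
      · refine ⟨t, t + 1, ht.le, by linarith, fun x hx => ?_⟩
        have h1 : 0 < x - t := by linarith [hx.1]
        have h2 : |x - t| ≠ 0 := abs_ne_zero.2 h1.ne'
        simp only [weight, heaviside, h1, if_true, mul_one]
        have := (Real.rpow_pos_of_pos (ht.trans hx.1) α).ne'
        have := (Real.rpow_pos_of_pos (lt_of_le_of_ne (abs_nonneg _) h2.symm) γ).ne'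
        positivity
    obtain ⟨a, b, ha, hab, hw⟩ := key
    have hfin : volume (p.roots.toFinset : Set ℝ) = 0 := (Finset.finite_toSet _).measure_zero _
    have hle : volume (Ioo a b \ (p.roots.toFinset : Set ℝ)) ≤
        volume (Function.support (fun x => p.eval x * p.eval x * weight α γ A B t x) ∩
          Ioi 0) := by
      refine measure_mono fun x hx => ⟨?_, lt_of_le_of_lt ha hx.1.1⟩
      have hr : p.eval x ≠ 0 := fun h => hx.2 (by simp [hp, h])
      exact mul_ne_zero (mul_ne_zero hr hr) (hw x hx.1)
    refine lt_of_lt_of_le ?_ hle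
    rw [measure_sdiff_null hfin, Real.volume_Ioo]
    simpa using hab
  · refine (ae_restrict_iff' measurableSet_Ioi).2 (ae_of_all _ fun x hx => ?_)
    exact mul_nonneg (mul_self_nonneg _) (weight_nonneg hA hAB hx)

theorem pairing_comm (w : ℝ → ℝ) (p q : Polynomial ℝ) : pairing w p q = pairing w q p := by
  unfold pairing
  congr 1
  ext x
  ring

theorem pairing_monicOP_of_lt {α γ A B t : ℝ} (hα : 0 < α) (hγ : 0 < γ) (hA : 0 ≤ A)
    (hAB : 0 ≤ A + B) (h0 : A ≠ 0 ∨ A + B ≠ 0) (ht : 0 < t) (n : ℕ) :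
    ∀ m < n, pairing (weight α γ A B t) (monicOP (weight α γ A B t) n)
      (monicOP (weight α γ A B t) m) = 0 := by
  set w := weight α γ A B t with hw
  have hI : ∀ p q : Polynomial ℝ,
      IntegrableOn (fun x => p.eval x * q.eval x * w x) (Ioi 0) := by
    intro p q
    have := integrableOn_weight (A := A) (B := B) hα hγ t (p * q)
    simpa only [Polynomial.eval_mul] using this
  induction n using Nat.strong_induction_on with
  | _ n ih =>
    intro m hm
    have hort : ∀ k < n, k ≠ m → pairing w (monicOP w k) (monicOP w m) = 0 := by
      intro k hk hkm
      rcases lt_or_gt_of_ne hkm with h | h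
      · rw [pairing_comm]; exact ih m hm k h
      · exact ih k hk m h
    have hpos := pairing_self_pos hα hγ hA hAB h0 ht (monicOP_monic w m).ne_zero
    set c : ℕ → ℝ := fun k => pairing w (Polynomial.X ^ n) (monicOP w k) /
      pairing w (monicOP w k) (monicOP w k) with hc
    have e : pairing w (monicOP w n) (monicOP w m) =
        pairing w (Polynomial.X ^ n) (monicOP w m) -
          ∑ k : Fin n, c k * pairing w (monicOP w k) (monicOP w m) := by
      unfold pairing
      simp_rw [← integral_const_mul]
      have hk : ∀ k ∈ (Finset.univ : Finset (Fin n)), Integrable (fun x => c k *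
          ((monicOP w k).eval x * (monicOP w m).eval x * w x)) (volume.restrict (Ioi 0)) :=
        fun k _ => (hI (monicOP w k) (monicOP w m)).const_mul _
      rw [← integral_finsetSum _ hk, ← integral_sub (hI _ _) (integrable_finsetSum _ hk)]
      congr 1
      ext x
      rw [monicOP.eq_1 w n]
      simp only [Polynomial.eval_sub, Polynomial.eval_finsetSum, Polynomial.eval_mul,
        Polynomial.eval_C, sub_mul, Finset.sum_mul]
      congr 1
      refine Finset.sum_congr rfl fun k _ => ?_
      simp only [hc]
      ring
    rw [e, Finset.sum_eq_single (⟨m, hm⟩ : Fin n)]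
    · simp only [hc]
      rw [div_mul_cancel₀ _ hpos.ne', sub_self]
    · intro k _ hk
      rw [hort k k.2 (fun h => hk (Fin.ext h)), mul_zero]
    · simp

theorem pairing_monicOP_of_ne {α γ A B t : ℝ} (hα : 0 < α) (hγ : 0 < γ) (hA : 0 ≤ A)
    (hAB : 0 ≤ A + B) (h0 : A ≠ 0 ∨ A + B ≠ 0) (ht : 0 < t) {m n : ℕ} (hmn : m ≠ n) :
    pairing (weight α γ A B t) (monicOP (weight α γ A B t) m)
      (monicOP (weight α γ A B t) n) = 0 := by
  rcases lt_or_gt_of_ne hmn with h | h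
  · rw [pairing_comm]; exact pairing_monicOP_of_lt hα hγ hA hAB h0 ht n m h
  · exact pairing_monicOP_of_lt hα hγ hA hAB h0 ht m n h

theorem h_pos {α γ A B t : ℝ} (hα : 0 < α) (hγ : 0 < γ) (hA : 0 ≤ A)
    (hAB : 0 ≤ A + B) (h0 : A ≠ 0 ∨ A + B ≠ 0) (ht : 0 < t) (n : ℕ) :
    0 < h α γ A B n t := by
  have := pairing_self_pos hα hγ hA hAB h0 ht (monicOP_monic (weight α γ A B t) n).ne_zero
  simpa only [pairing, h, P, sq] using this

end PerturbedLaguerre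

end

/-!
The substitution `x = t u` moves the singularity of the weight from `t` to `1` and turns the weight,
up to a power of `t`, into `u ^ α |u - 1| ^ γ (A + B θ(u - 1)) e ^ (-t u)`.  Now `t` enters only
through the exponential, so differentiation in `t` multiplies the functional
`L p = ∫₀^∞ p(u) w(u) du` by `-u` (`hasDerivAt_integral_scaledWeight`), the Gram–Schmidt polynomials
`Q_n` have differentiable coefficients (`exists_hasCoeffDerivAt_monicOP`), and the recurrence
coefficients of `u Q_n = Q_{n+1} + a_n Q_n + b_n Q_{n-1}` satisfy the Toda equations.  The
`t`-derivative `E` of `Q_n` is the last term `b_n Q_{n-1}` of the recurrence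
(`isLowerPart_of_hasCoeffDerivAt`).

The logarithmic derivative of the scaled weight is `α / u + γ / (u - 1) - t`.  Let `M₀` and `M₁` be
the functionals with the additional factors `1 / u` and `1 / (u - 1)`.  Everything needed about the
weight is contained in `M₀ (X p) = L p`, `M₁ ((X - 1) p) = L p`, positivity, and integration by parts
`L p' + α M₀ p + γ M₁ p = t L p` (`Semiclassical`).  With `h = L (Q_n ^ 2)` and `p_n` the subleading
coefficient of `Q_n` put
`t R_n = γ M₁ (Q_n ^ 2) / h`, `x = γ M₁ (E Q_n) / h`, `z = γ M₁ (E ^ 2) / h`.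
Integration by parts yields `R_n = a_n - (2 n + 1 + α + γ) / t` and `x = t b_n + p_n`, which makes
`R_n` and `x` differentiable.  Since `M₁ (Q_n ^ 2)`, `M₁ (E Q_n)` and `M₁ (E ^ 2)` factor through
values at `1`, they obey a quadratic relation (`IsLowerPart.double_pole`), and so do their analogues
for `M₀`:
`x ^ 2 - γ x = t R_n z` and `(x + n) (x + n + α) = (t - t R_n) (t b_n - z)`.

The Toda equations become
`t R_n' = t R_n ^ 2 + (2 n + 1 + α + γ - t) R_n - γ + 2 x - R_n` (`hasDerivAt_R`) and
`x' = z - b_n t R_n` (`exists_quadratic_relations`).  Multiplying the second by `R_n (1 - R_n)`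
eliminates `b_n` and `z`, and the first expresses `x` through `R_n` and `R_n'`; the result is the
second-order equation for `R_n` (`ode_of_system`), also where `R_n = 0`.  Moreover
`t (1 - R_n) = α M₀ (Q_n ^ 2) / h` is positive, so `R_n < 1`, and `R_n / (R_n - 1)` turns the equation
into Painlevé V (`painleve_of_ode`).
-/

noncomputable section

namespace PerturbedLaguerre

/-! ### Semiclassical functionals on polynomials -/

open Polynomial in
/-- `Q` is the monic orthogonal polynomial of degree `n` of the linear functional `L`. -/
structure IsMonicOrthogonal (L : ℝ[X] →ₗ[ℝ] ℝ) (n : ℕ) (Q : ℝ[X]) : Prop where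
  monic : Q.Monic
  natDegree_eq : Q.natDegree = n
  orthogonal : ∀ q : ℝ[X], q.degree < n → L (Q * q) = 0

open Polynomial in
/-- `E` is the orthogonal projection of `X * Q` onto the polynomials of degree less than `n`.
If `Q` is the monic orthogonal polynomial of degree `n`, then `E` is the last term
`b * Q_{n-1}` of the three-term recurrence (and zero for `n = 0`). -/
structure IsLowerPart (L : ℝ[X] →ₗ[ℝ] ℝ) (n : ℕ) (Q E : ℝ[X]) : Prop where
  degree_lt : E.degree < n
  apply_mul : ∀ q : ℝ[X], q.degree < n → L (E * q) = L (X * Q * q)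

open Polynomial in
/-- The functionals `L p = ∫ p w`, `M₀ p = ∫ p w / x` and `M₁ p = ∫ p w / (x - 1)` of a weight `w`
with `w' / w = α / x + γ / (x - 1) - t`, reduced to the properties on which the algebra of
the orthogonal polynomials rests; `parts` is integration by parts. -/
structure Semiclassical (α γ t : ℝ) (L M₀ M₁ : ℝ[X] →ₗ[ℝ] ℝ) : Prop where
  apply_X_mul : ∀ p, M₀ (X * p) = L p
  apply_X_sub_one_mul : ∀ p, M₁ ((X - 1) * p) = L p
  parts : ∀ p, L (derivative p) + α * M₀ p + γ * M₁ p = t * L p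
  pos : ∀ p, p ≠ 0 → 0 < L (p * p)

section Algebra

open Polynomial

variable {L M₀ M₁ : ℝ[X] →ₗ[ℝ] ℝ} {n : ℕ} {Q E : ℝ[X]} {α γ t : ℝ}

theorem degree_lt_of_coeff_eq_zero {q : ℝ[X]} (hq : q.natDegree ≤ n) (h0 : q.coeff n = 0) :
    q.degree < n := by
  rw [degree_lt_iff_coeff_zero]
  intro m hm
  rcases hm.eq_or_lt with rfl | h
  · exact h0
  · exact coeff_eq_zero_of_natDegree_lt (by omega)

theorem degree_derivative_lt' {q : ℝ[X]} (hq : q.degree < n) : q.derivative.degree < n :=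
  (degree_derivative_le).trans_lt hq

theorem degree_X_mul_derivative_lt {q : ℝ[X]} (hq : q.degree < n) :
    (X * derivative q).degree < (n : WithBot ℕ) := by
  rw [degree_lt_iff_coeff_zero] at hq ⊢
  intro m hm
  rcases m with _ | m
  · simp
  · rw [coeff_X_mul, coeff_derivative, hq _ hm, zero_mul]

theorem C_smul_apply (L : ℝ[X] →ₗ[ℝ] ℝ) (c : ℝ) (p : ℝ[X]) : L (C c * p) = c * L p := by
  rw [← smul_eq_C_mul, map_smul, smul_eq_mul]

theorem IsMonicOrthogonal.coeff_self (hQ : IsMonicOrthogonal L n Q) : Q.coeff n = 1 := by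
  have := hQ.monic.coeff_natDegree
  rwa [hQ.natDegree_eq] at this

/-- Only the coefficient of `X ^ n` is seen by pairing with the orthogonal polynomial. -/
theorem IsMonicOrthogonal.apply_mul (hQ : IsMonicOrthogonal L n Q) {q : ℝ[X]}
    (hq : q.natDegree ≤ n) : L (Q * q) = q.coeff n * L (Q * Q) := by
  have h1 : (q - C (q.coeff n) * Q).degree < n := by
    apply degree_lt_of_coeff_eq_zero
    · exact (natDegree_sub_le_of_le hq ((natDegree_C_mul_le _ _).trans hQ.natDegree_eq.le)).trans
        (by simp)
    · simp [hQ.coeff_self]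
  have h2 := hQ.orthogonal _ h1
  rw [show Q * (q - C (q.coeff n) * Q) = Q * q - C (q.coeff n) * (Q * Q) by ring, map_sub,
    C_smul_apply] at h2
  linarith

/-- On polynomials of degree less than `n`, pairing with the lower part reads off the coefficient
of `X ^ (n - 1)`, and for `n = 0` nothing. -/
theorem IsLowerPart.apply_mul_eq_coeff (hQ : IsMonicOrthogonal L n Q) (hE : IsLowerPart L n Q E)
    {q : ℝ[X]} (hq : q.degree < n) : L (E * q) = (X * q).coeff n * L (Q * Q) := by
  rw [hE.apply_mul q hq, show X * Q * q = Q * (X * q) by ring, hQ.apply_mul]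
  rw [natDegree_le_iff_coeff_eq_zero]
  intro m hm
  rcases m with _ | m
  · simp
  · rw [coeff_X_mul]
    exact coeff_eq_zero_of_degree_lt (hq.trans_le (by exact_mod_cast Nat.lt_succ_iff.1 hm))

/-- `q(x) = q(c) + (x - c) r(x)` with `r` of smaller degree. -/
theorem exists_eq_C_add_mul (q : ℝ[X]) (c : ℝ) :
    ∃ r : ℝ[X], q = C (q.eval c) + (X - C c) * r ∧ r = q /ₘ (X - C c) :=
  ⟨q /ₘ (X - C c), by
    have := modByMonic_add_div q (X - C c)
    rw [modByMonic_X_sub_C_eq_C_eval] at this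
    exact this.symm, rfl⟩

theorem degree_divByMonic_lt' {q : ℝ[X]} (hq : q.degree < n) (c : ℝ) :
    (q /ₘ (X - C c)).degree < n := (degree_divByMonic_le _ _).trans_lt hq

theorem natDegree_divByMonic_X_sub_C (q : ℝ[X]) (c : ℝ) :
    (q /ₘ (X - C c)).natDegree = q.natDegree - 1 := by
  rw [natDegree_divByMonic _ (monic_X_sub_C c), natDegree_X_sub_C]

/-- The quotient by `X - c` has degree one less. -/
theorem coeff_X_mul_divByMonic {q : ℝ[X]} {c : ℝ} {m : ℕ} (hq : q.natDegree ≤ m) (hm : m ≠ 0) :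
    (X * (q /ₘ (X - C c))).coeff m = q.coeff m := by
  obtain ⟨r, hr, hr'⟩ := exists_eq_C_add_mul q c
  rw [← hr']
  conv_rhs => rw [hr]
  have h1 : r.coeff m = 0 := by
    apply coeff_eq_zero_of_natDegree_lt
    rw [hr', natDegree_divByMonic_X_sub_C]; omega
  obtain ⟨k, rfl⟩ := Nat.exists_eq_succ_of_ne_zero hm
  simp [sub_mul, coeff_X_mul, h1]

theorem IsLowerPart.eq_zero (hE : IsLowerPart L 0 Q E) : E = 0 := by
  have := hE.degree_lt
  simpa using this

section DoublePole

variable {M : ℝ[X] →ₗ[ℝ] ℝ} {c : ℝ}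

theorem apply_mul_eq_eval_mul (hM : ∀ p, M ((X - C c) * p) = L p) (p q : ℝ[X]) :
    M (q * p) = q.eval c * M p + L (p * (q /ₘ (X - C c))) := by
  obtain ⟨r, hr, hr'⟩ := exists_eq_C_add_mul q c
  rw [← hr', ← hM]
  conv_lhs => rw [hr]
  rw [show (C (eval c q) + (X - C c) * r) * p = C (q.eval c) * p + (X - C c) * (p * r) by ring,
    map_add, C_smul_apply]

/-- A quadratic relation between the residues at a simple pole `c` of `w' / w`.  All three entries
factor through evaluation at `c`, up to the term `L (Q * Q)` coming from the leading
coefficient of `Q`. -/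
theorem IsLowerPart.double_pole (hQ : IsMonicOrthogonal L n Q) (hE : IsLowerPart L n Q E)
    (hM : ∀ p, M ((X - C c) * p) = L p) :
    M (E * Q) ^ 2 - L (Q * Q) * M (E * Q) = M (Q * Q) * M (E * E) := by
  rcases Nat.eq_zero_or_pos n with rfl | hn
  · rw [hE.eq_zero]; simp
  have hn0 : n ≠ 0 := hn.ne'
  -- The quotient of `Q` by `X - c` is monic of degree `n - 1`, hence orthogonal to `Q` but not
  -- to `E`; the quotient of `E` has degree below `n - 1` and is orthogonal to both.
  have hQd : (Q /ₘ (X - C c)).degree < n := by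
    apply degree_lt_of_coeff_eq_zero
    · rw [natDegree_divByMonic_X_sub_C, hQ.natDegree_eq]; omega
    · apply coeff_eq_zero_of_natDegree_lt
      rw [natDegree_divByMonic_X_sub_C, hQ.natDegree_eq]; omega
  have e1 : M (Q * Q) = Q.eval c * M Q := by
    rw [apply_mul_eq_eval_mul hM, hQ.orthogonal _ hQd, add_zero]
  have e2 : M (E * Q) = E.eval c * M Q := by
    rw [apply_mul_eq_eval_mul hM, hQ.orthogonal _ (degree_divByMonic_lt' hE.degree_lt c),
      add_zero]
  have e3 : M (E * Q) = Q.eval c * M E + L (Q * Q) := by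
    rw [mul_comm, apply_mul_eq_eval_mul hM, hE.apply_mul_eq_coeff hQ hQd,
      coeff_X_mul_divByMonic hQ.natDegree_eq.le hn0, hQ.coeff_self, one_mul]
  have e4 : M (E * E) = E.eval c * M E := by
    rw [apply_mul_eq_eval_mul hM,
      hE.apply_mul_eq_coeff hQ (degree_divByMonic_lt' hE.degree_lt c),
      coeff_X_mul_divByMonic (natDegree_le_of_degree_le hE.degree_lt.le) hn0,
      coeff_eq_zero_of_degree_lt hE.degree_lt]
    ring
  rw [e1, e4]
  linear_combination M (E * Q) * e3 + (Q.eval c * M E) * e2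

end DoublePole

/-- A polynomial of degree less than `n` is determined by its pairings with such polynomials. -/
theorem eq_of_forall_apply_mul_eq (hpos : ∀ p : ℝ[X], p ≠ 0 → 0 < L (p * p)) {p q : ℝ[X]}
    (hp : p.degree < n) (hq : q.degree < n)
    (h : ∀ r : ℝ[X], r.degree < n → L (p * r) = L (q * r)) : p = q := by
  by_contra hne
  have h1 := hpos _ (sub_ne_zero.2 hne)
  have h2 := h (p - q) ((degree_sub_le _ _).trans_lt (max_lt hp hq))
  rw [sub_mul, map_sub, h2, sub_self] at h1
  exact lt_irrefl _ h1

/-- The last term of the three-term recurrence is a multiple of the preceding polynomial. -/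
theorem IsLowerPart.eq_C_mul (hpos : ∀ p : ℝ[X], p ≠ 0 → 0 < L (p * p)) {m : ℕ} {Q' : ℝ[X]}
    (hQ : IsMonicOrthogonal L (m + 1) Q) (hQ' : IsMonicOrthogonal L m Q')
    (hE : IsLowerPart L (m + 1) Q E) : E = C (L (Q * Q) / L (Q' * Q')) * Q' := by
  have h' := (hpos _ hQ'.monic.ne_zero).ne'
  refine eq_of_forall_apply_mul_eq hpos hE.degree_lt ?_ fun r hr => ?_
  · rw [← smul_eq_C_mul]
    refine (degree_smul_le _ _).trans_lt ?_
    rw [degree_eq_natDegree hQ'.monic.ne_zero, hQ'.natDegree_eq]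
    exact_mod_cast Nat.lt_succ_self m
  · have hr' : r.natDegree ≤ m := by
      by_cases h0 : r = 0
      · simp [h0]
      · exact Nat.lt_succ_iff.1 ((natDegree_lt_iff_degree_lt h0).2 hr)
    rw [hE.apply_mul_eq_coeff hQ hr, mul_assoc, C_smul_apply, hQ'.apply_mul hr', coeff_X_mul]
    field_simp

/-! ### Consequences of integration by parts -/

theorem IsMonicOrthogonal.degree_derivative_lt (hQ : IsMonicOrthogonal L n Q) :
    (derivative Q).degree < n := by
  have h := Polynomial.degree_derivative_lt hQ.monic.ne_zero
  rwa [degree_eq_natDegree hQ.monic.ne_zero, hQ.natDegree_eq] at h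

theorem IsMonicOrthogonal.natDegree_X_mul_derivative_le (hQ : IsMonicOrthogonal L n Q) :
    (X * derivative Q).natDegree ≤ n := by
  rw [natDegree_le_iff_coeff_eq_zero]
  intro m hm
  rcases m with _ | m
  · simp
  · rw [coeff_X_mul]
    exact coeff_eq_zero_of_degree_lt (hQ.degree_derivative_lt.trans_le
      (by exact_mod_cast Nat.lt_succ_iff.1 hm))

theorem IsMonicOrthogonal.coeff_X_mul_derivative (hQ : IsMonicOrthogonal L n Q) :
    (X * derivative Q).coeff n = (n : ℝ) := by
  rcases n with _ | n
  · simp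
  · rw [coeff_X_mul, coeff_derivative, hQ.coeff_self]; simp

theorem IsMonicOrthogonal.apply_derivative (hQ : IsMonicOrthogonal L n Q) :
    L (Q * derivative Q) = 0 :=
  hQ.orthogonal _ hQ.degree_derivative_lt

theorem IsMonicOrthogonal.apply_X_mul_derivative (hQ : IsMonicOrthogonal L n Q) :
    L (Q * (X * derivative Q)) = n * L (Q * Q) := by
  rw [hQ.apply_mul hQ.natDegree_X_mul_derivative_le, hQ.coeff_X_mul_derivative]

/-- The Euler operator `x d/dx - n` kills the leading term of `Q`. -/
theorem IsMonicOrthogonal.degree_euler_lt (hQ : IsMonicOrthogonal L n Q) :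
    (X * derivative Q - C (n : ℝ) * Q).degree < (n : WithBot ℕ) := by
  apply degree_lt_of_coeff_eq_zero
  · exact (natDegree_sub_le_of_le hQ.natDegree_X_mul_derivative_le
      ((natDegree_C_mul_le _ _).trans hQ.natDegree_eq.le)).trans (by simp)
  · rw [coeff_sub, hQ.coeff_X_mul_derivative, coeff_C_mul, hQ.coeff_self]; ring

theorem IsMonicOrthogonal.coeff_X_mul_euler (hQ : IsMonicOrthogonal L n Q) :
    (X * (X * derivative Q - C (n : ℝ) * Q)).coeff n = -(X * Q).coeff n := by
  rcases n with _ | _ | n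
  · simp
  · simp
  · simp only [coeff_X_mul, coeff_sub, coeff_C_mul, coeff_derivative]
    push_cast; ring

theorem IsLowerPart.apply_mul_self (hQ : IsMonicOrthogonal L n Q) (hE : IsLowerPart L n Q E) :
    L (E * E) = (X * E).coeff n * L (Q * Q) :=
  hE.apply_mul_eq_coeff hQ hE.degree_lt

theorem IsLowerPart.apply_X_mul (hQ : IsMonicOrthogonal L n Q) (hE : IsLowerPart L n Q E) :
    L (X * Q * E) = (X * E).coeff n * L (Q * Q) := by
  rw [← hE.apply_mul _ hE.degree_lt, hE.apply_mul_self hQ]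

theorem IsLowerPart.apply_derivative (hQ : IsMonicOrthogonal L n Q) (hE : IsLowerPart L n Q E) :
    L (E * derivative E) = 0 := by
  rw [hE.apply_mul_eq_coeff hQ (degree_derivative_lt' hE.degree_lt),
    coeff_eq_zero_of_degree_lt (degree_X_mul_derivative_lt hE.degree_lt), zero_mul]

theorem IsLowerPart.apply_derivative_right (hQ : IsMonicOrthogonal L n Q)
    (hE : IsLowerPart L n Q E) : L (E * derivative Q) = n * L (Q * Q) := by
  rw [hE.apply_mul_eq_coeff hQ hQ.degree_derivative_lt, hQ.coeff_X_mul_derivative]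

theorem IsLowerPart.apply_X_mul_derivative (hQ : IsMonicOrthogonal L n Q)
    (hE : IsLowerPart L n Q E) :
    L (E * (X * derivative Q)) = -((X * Q).coeff n * L (Q * Q)) := by
  have h1 := hE.apply_mul_eq_coeff hQ hQ.degree_euler_lt
  rw [hQ.coeff_X_mul_euler, show E * (X * derivative Q - C (n : ℝ) * Q)
    = E * (X * derivative Q) - C (n : ℝ) * (Q * E) by ring, map_sub, C_smul_apply,
    hQ.orthogonal _ hE.degree_lt] at h1
  linarith

theorem IsMonicOrthogonal.apply_X_sq_mul_derivative (hQ : IsMonicOrthogonal L n Q) :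
    L (X ^ 2 * (Q * derivative Q)) = n * L (X * Q * Q) - (X * Q).coeff n * L (Q * Q) := by
  have hd : (X * (X * derivative Q - C (n : ℝ) * Q)).natDegree ≤ n := by
    rw [natDegree_le_iff_coeff_eq_zero]
    intro m hm
    rcases m with _ | m
    · simp
    · rw [coeff_X_mul]
      exact coeff_eq_zero_of_degree_lt (hQ.degree_euler_lt.trans_le
        (by exact_mod_cast Nat.lt_succ_iff.1 hm))
  have h1 := hQ.apply_mul hd
  rw [hQ.coeff_X_mul_euler, show Q * (X * (X * derivative Q - C (n : ℝ) * Q))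
    = X ^ 2 * (Q * derivative Q) - C (n : ℝ) * (X * Q * Q) by ring, map_sub, C_smul_apply] at h1
  linarith

namespace Semiclassical

theorem M₁_X_mul (hS : Semiclassical α γ t L M₀ M₁) (p : ℝ[X]) :
    M₁ (X * p) = L p + M₁ p := by
  rw [← hS.apply_X_sub_one_mul, ← map_add]
  congr 1; ring

theorem parts_mul (hS : Semiclassical α γ t L M₀ M₁) (p q : ℝ[X]) :
    L (p * derivative q) + L (q * derivative p) + α * M₀ (p * q) + γ * M₁ (p * q)
      = t * L (p * q) := by
  rw [← hS.parts, ← map_add]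
  congr 4
  rw [derivative_mul]; ring

/-- The residues of the first ladder operator coefficient sum to `t`. -/
theorem parts_sq (hS : Semiclassical α γ t L M₀ M₁) (hQ : IsMonicOrthogonal L n Q) :
    α * M₀ (Q * Q) + γ * M₁ (Q * Q) = t * L (Q * Q) := by
  rw [← hS.parts_mul, hQ.apply_derivative]; ring

/-- Integration by parts with `E ^ 2`; here `(X * E).coeff n` is the recurrence coefficient `b_n`. -/
theorem parts_lower_sq (hS : Semiclassical α γ t L M₀ M₁) (hQ : IsMonicOrthogonal L n Q)
    (hE : IsLowerPart L n Q E) :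
    α * M₀ (E * E) + γ * M₁ (E * E) = t * ((X * E).coeff n * L (Q * Q)) := by
  rw [← hE.apply_mul_self hQ, ← hS.parts_mul, hE.apply_derivative hQ]; ring

/-- Integration by parts with `E * Q`: the residues of the second ladder operator coefficient sum
to `-n`. -/
theorem parts_lower_mul (hS : Semiclassical α γ t L M₀ M₁) (hQ : IsMonicOrthogonal L n Q)
    (hE : IsLowerPart L n Q E) :
    α * M₀ (E * Q) + γ * M₁ (E * Q) = -(n * L (Q * Q)) := by
  have h := hS.parts_mul E Q
  rw [hE.apply_derivative_right hQ, hQ.orthogonal _ (degree_derivative_lt' hE.degree_lt),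
    mul_comm E Q, hQ.orthogonal _ hE.degree_lt] at h
  rw [mul_comm E Q]
  linarith

/-- Integration by parts with `X * Q ^ 2` expresses the residue at `1` through the recurrence
coefficient `a_n = L (X * Q * Q) / L (Q * Q)`. -/
theorem parts_X_mul_sq (hS : Semiclassical α γ t L M₀ M₁) (hQ : IsMonicOrthogonal L n Q) :
    (2 * n + 1 + α + γ) * L (Q * Q) + γ * M₁ (Q * Q) = t * L (X * Q * Q) := by
  have h := hS.parts_mul (X * Q) Q
  rw [show X * Q * derivative Q = Q * (X * derivative Q) by ring,
    show Q * derivative (X * Q) = Q * Q + Q * (X * derivative Q) by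
      rw [derivative_mul, derivative_X]; ring, map_add, hQ.apply_X_mul_derivative,
    show X * Q * Q = X * (Q * Q) by ring, hS.apply_X_mul, hS.M₁_X_mul] at h
  rw [mul_assoc X Q Q]
  linarith

/-- Integration by parts with `X * E * Q` expresses the residue at `1` of the second ladder operator
coefficient as `t b_n + p_n`, where `p_n` is the subleading coefficient of `Q`. -/
theorem parts_X_mul_lower (hS : Semiclassical α γ t L M₀ M₁) (hQ : IsMonicOrthogonal L n Q)
    (hE : IsLowerPart L n Q E) :
    γ * M₁ (E * Q) - (X * Q).coeff n * L (Q * Q) = t * ((X * E).coeff n * L (Q * Q)) := by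
  have h := hS.parts_mul (X * E) Q
  have h0 : L (E * Q) = 0 := by rw [mul_comm, hQ.orthogonal _ hE.degree_lt]
  rw [show X * E * derivative Q = E * (X * derivative Q) by ring,
    show Q * derivative (X * E) = E * Q + Q * (X * derivative E) by
      rw [derivative_mul, derivative_X]; ring, map_add, hE.apply_X_mul_derivative hQ,
    hQ.orthogonal _ (degree_X_mul_derivative_lt hE.degree_lt),
    show X * E * Q = X * (E * Q) by ring, hS.apply_X_mul, hS.M₁_X_mul, h0,
    show X * (E * Q) = X * Q * E by ring, hE.apply_X_mul hQ] at h
  linarith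

/-- Integration by parts with `X * (X - 1) * Q ^ 2`.  It replaces `b_{n+1}`, which enters the
derivative of `a_n`, by quantities of index `n`. -/
theorem parts_X_mul_X_sub_one_mul_sq (hS : Semiclassical α γ t L M₀ M₁)
    (hQ : IsMonicOrthogonal L n Q) :
    t * L (X ^ 2 * (Q * Q)) = (t + 2 + α + γ + 2 * n) * L (X * Q * Q)
      - (1 + α + 2 * n + 2 * (X * Q).coeff n) * L (Q * Q) := by
  have h := hS.parts (X * ((X - 1) * (Q * Q)))
  have e1 : derivative (X * ((X - 1) * (Q * Q))) = X * Q * Q + X * Q * Q - Q * Q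
      + X ^ 2 * (Q * derivative Q) + X ^ 2 * (Q * derivative Q)
      - Q * (X * derivative Q) - Q * (X * derivative Q) := by
    simp only [derivative_mul, derivative_sub, derivative_X, derivative_one]; ring
  have e2 : M₁ (X * ((X - 1) * (Q * Q))) = L (X * Q * Q) := by
    rw [← hS.apply_X_sub_one_mul]; congr 1; ring
  have e3 : L ((X - 1) * (Q * Q)) = L (X * Q * Q) - L (Q * Q) := by
    rw [← map_sub]; congr 1; ring
  have e4 : L (X * ((X - 1) * (Q * Q))) = L (X ^ 2 * (Q * Q)) - L (X * Q * Q) := by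
    rw [← map_sub]; congr 1; ring
  rw [e1, e2, hS.apply_X_mul, e3, e4] at h
  simp only [map_add, map_sub, hQ.apply_X_mul_derivative, hQ.apply_X_sq_mul_derivative] at h
  linarith

/-- The two quadratic relations at the poles `0` and `1`, after the residues at `0` have been
eliminated by integration by parts. -/
theorem quadratic_relations (hS : Semiclassical α γ t L M₀ M₁) (hQ : IsMonicOrthogonal L n Q)
    (hE : IsLowerPart L n Q E) {r x z : ℝ} (hr : r = γ * M₁ (Q * Q) / L (Q * Q))
    (hx : x = γ * M₁ (E * Q) / L (Q * Q)) (hz : z = γ * M₁ (E * E) / L (Q * Q)) :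
    x ^ 2 - γ * x = r * z ∧
      (x + n) * (x + n + α) = (t - r) * (t * (X * E).coeff n - z) := by
  have h := (hS.pos Q hQ.monic.ne_zero).ne'
  -- Both relations are `double_pole` divided by `L (Q * Q) ^ 2`.
  have d1 := hE.double_pole hQ (M := M₁) (c := 1) hS.apply_X_sub_one_mul
  have d0 := hE.double_pole hQ (M := M₀) (c := 0) (by simpa using hS.apply_X_mul)
  have e1 : t - r = α * M₀ (Q * Q) / L (Q * Q) := by
    rw [hr]; field_simp; linarith [hS.parts_sq hQ]
  have e2 : t * (X * E).coeff n - z = α * M₀ (E * E) / L (Q * Q) := by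
    rw [hz]; field_simp; linarith [hS.parts_lower_sq hQ hE]
  have e3 : x + n = -(α * M₀ (E * Q)) / L (Q * Q) := by
    rw [hx]; field_simp; linarith [hS.parts_lower_mul hQ hE]
  refine ⟨?_, ?_⟩
  · rw [hx, hr, hz]
    field_simp
    linear_combination γ ^ 2 * d1
  · rw [e1, e2, e3]
    field_simp
    linear_combination α ^ 2 * d0

end Semiclassical
end Algebra

/-! ### The weight with its singularity moved to `1` -/

section ScaledWeight

open Polynomial

/-- The weight after the substitution `x = t * u`, up to the constant `t ^ (α + γ)`.  Its
singularities are at the fixed points `0` and `1`, and it depends on `t` only through the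
factor `exp (-(t * u))`. -/
def scaledWeight (α γ A B t u : ℝ) : ℝ :=
  u ^ α * |u - 1| ^ γ * (A + B * heaviside (u - 1)) * Real.exp (-(t * u))

variable {α γ A B t : ℝ}

theorem heaviside_mul_of_pos (ht : 0 < t) (x : ℝ) : heaviside (t * x) = heaviside x := by
  simp [heaviside, mul_pos_iff_of_pos_left ht]

theorem weight_mul (ht : 0 < t) {u : ℝ} (hu : 0 < u) :
    weight α γ A B t (t * u) = t ^ (α + γ) * scaledWeight α γ A B t u := by
  unfold weight scaledWeight
  rw [show t * u - t = t * (u - 1) by ring, heaviside_mul_of_pos ht, abs_mul, abs_of_pos ht,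
    Real.mul_rpow ht.le hu.le, Real.mul_rpow ht.le (abs_nonneg _), Real.rpow_add ht]
  ring

theorem eval_comp_C_mul_X (p : ℝ[X]) (c u : ℝ) : (p.comp (C c * X)).eval u = p.eval (c * u) := by
  simp [eval_comp]

theorem comp_C_mul_X_comp (p : ℝ[X]) {c d : ℝ} (h : c * d = 1) :
    (p.comp (C c * X)).comp (C d * X) = p := by
  rw [comp_assoc]
  simp [← mul_assoc, ← C_mul, h]

theorem integrableOn_scaledWeight (hα : 0 < α) (hγ : 0 < γ) (ht : 0 < t) (p : ℝ[X]) :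
    IntegrableOn (fun u => p.eval u * scaledWeight α γ A B t u) (Ioi 0) := by
  have h1 := integrableOn_weight (A := A) (B := B) hα hγ t (p.comp (C t⁻¹ * X))
  rw [← mul_zero t] at h1
  have h2 := (integrableOn_Ioi_comp_mul_left_iff _ 0 ht).2 h1
  refine IntegrableOn.congr_fun (h2.const_mul (t ^ (α + γ))⁻¹) (fun u hu => ?_) measurableSet_Ioi
  have ht' : t ^ (α + γ) ≠ 0 := (Real.rpow_pos_of_pos ht _).ne'
  simp only [eval_comp_C_mul_X, weight_mul ht hu, inv_mul_cancel_left₀ ht.ne']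
  field_simp

theorem pairing_weight (ht : 0 < t) (p q : ℝ[X]) :
    pairing (weight α γ A B t) p q = t * t ^ (α + γ) *
      pairing (scaledWeight α γ A B t) (p.comp (C t * X)) (q.comp (C t * X)) := by
  unfold pairing
  have h := integral_comp_mul_left_Ioi
    (fun x => p.eval x * q.eval x * weight α γ A B t x) 0 ht
  rw [mul_zero, smul_eq_mul, eq_inv_mul_iff_mul_eq₀ ht.ne'] at h
  rw [← h, mul_assoc, ← integral_const_mul (t ^ (α + γ))]
  congr 1
  refine setIntegral_congr_fun measurableSet_Ioi fun u hu => ?_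
  simp only [eval_comp_C_mul_X, weight_mul ht hu]
  ring

theorem pairing_scaledWeight_self_pos (hα : 0 < α) (hγ : 0 < γ) (hA : 0 ≤ A)
    (hAB : 0 ≤ A + B) (h0 : A ≠ 0 ∨ A + B ≠ 0) (ht : 0 < t) {p : ℝ[X]} (hp : p ≠ 0) :
    0 < pairing (scaledWeight α γ A B t) p p := by
  have hp' : p.comp (C t⁻¹ * X) ≠ 0 := fun h => hp (by
    rw [← comp_C_mul_X_comp p (inv_mul_cancel₀ ht.ne'), h, zero_comp])
  have h1 := pairing_self_pos hα hγ hA hAB h0 ht hp'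
  rw [pairing_weight ht, comp_C_mul_X_comp p (inv_mul_cancel₀ ht.ne')] at h1
  have := Real.rpow_pos_of_pos ht (α + γ)
  exact (mul_pos_iff_of_pos_left (by positivity)).1 h1

/-- Gram–Schmidt commutes with a dilation of the line. -/
theorem monicOP_comp {v w : ℝ → ℝ} {c s : ℝ} (hc : c ≠ 0) (hs : s ≠ 0)
    (h : ∀ p q, pairing w p q = c * pairing v (p.comp (C s * X)) (q.comp (C s * X))) (n : ℕ) :
    (monicOP w n).comp (C s * X) = C (s ^ n) * monicOP v n := by
  have hpair : ∀ (a b : ℝ) (p q : ℝ[X]),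
      pairing v (C a * p) (C b * q) = a * b * pairing v p q := by
    intro a b p q
    unfold pairing
    rw [← integral_const_mul]
    congr 1; ext u
    simp only [eval_mul, eval_C]; ring
  have hX : ∀ n : ℕ, (X ^ n : ℝ[X]).comp (C s * X) = C (s ^ n) * X ^ n := by
    intro n; simp [mul_pow]
  induction n using Nat.strong_induction_on with
  | _ n ih =>
    rw [monicOP, monicOP, sub_comp, hX, mul_sub]
    congr 1
    rw [Polynomial.sum_comp, Finset.mul_sum]
    refine Finset.sum_congr rfl fun k _ => ?_
    rw [mul_comp, C_comp, h, h, hX, ih k k.2, hpair, hpair, ← mul_assoc (C _) (C _), ← C_mul,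
      ← mul_assoc (C (s ^ n)), ← C_mul]
    congr 2
    have h1 : s ^ (k : ℕ) ≠ 0 := pow_ne_zero _ hs
    rw [mul_div_mul_left _ _ hc, mul_assoc, mul_assoc (s ^ (k : ℕ)), mul_left_comm (s ^ n),
      mul_div_mul_left _ _ h1, div_mul_eq_mul_div, mul_comm, mul_div_mul_left _ _ h1, mul_div_assoc]

end ScaledWeight

/-! ### Integrability and integration by parts for the scaled weight -/

section Analysis

open Polynomial Filter Topology

variable {α γ A B t : ℝ}

theorem intervalIntegrable_abs_sub_rpow {r : ℝ} (hr : -1 < r) (c a b : ℝ) :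
    IntervalIntegrable (fun u => |u - c| ^ r) volume a b := by
  have h0 : ∀ d : ℝ, 0 ≤ d → IntervalIntegrable (fun u : ℝ => |u| ^ r) volume 0 d := by
    intro d hd
    refine (intervalIntegral.intervalIntegrable_rpow' hr (a := 0) (b := d)).congr ?_
    intro u hu
    rw [uIoc_of_le hd] at hu
    simp [abs_of_pos hu.1]
  have h1 : ∀ d : ℝ, IntervalIntegrable (fun u : ℝ => |u| ^ r) volume 0 d := by
    intro d
    rcases le_total 0 d with hd | hd
    · exact h0 d hd
    · have h := (IntervalIntegrable.iff_comp_neg (by simp)).1 (h0 (-d) (by linarith))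
      simpa using h
  have h2 := ((h1 (a - c)).symm.trans (h1 (b - c))).comp_sub_right c
  simpa using h2

/-- The jump at `1` is multiplied by a factor vanishing there, so the weight is continuous. -/
theorem scaledWeight_eq (hγ : 0 < γ) (u : ℝ) : scaledWeight α γ A B t u =
    u ^ α * (A * |u - 1| ^ γ + B * max (u - 1) 0 ^ γ) * Real.exp (-(t * u)) := by
  unfold scaledWeight heaviside
  split_ifs with h
  · rw [max_eq_left h.le, abs_of_pos h]; ring
  · rw [max_eq_right (not_lt.1 h), Real.zero_rpow hγ.ne']; ring

theorem continuous_scaledWeight (hα : 0 < α) (hγ : 0 < γ) :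
    Continuous (scaledWeight α γ A B t) := by
  rw [funext (scaledWeight_eq (α := α) (A := A) (B := B) (t := t) hγ)]
  have h1 : Continuous fun u : ℝ => u ^ α := Real.continuous_rpow_const hα.le
  have h2 : Continuous fun u : ℝ => u ^ γ := Real.continuous_rpow_const hγ.le
  have h3 : Continuous fun u : ℝ => |u - 1| ^ γ := h2.comp (by fun_prop)
  have h4 : Continuous fun u : ℝ => max (u - 1) 0 ^ γ := h2.comp (by fun_prop)
  fun_prop

theorem scaledWeight_zero (hα : 0 < α) : scaledWeight α γ A B t 0 = 0 := by
  simp [scaledWeight, Real.zero_rpow hα.ne']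

theorem scaledWeight_one (hγ : 0 < γ) : scaledWeight α γ A B t 1 = 0 := by
  simp [scaledWeight, Real.zero_rpow hγ.ne']

theorem scaledWeight_nonneg (hA : 0 ≤ A) (hAB : 0 ≤ A + B) {u : ℝ} (hu : 0 < u) :
    0 ≤ scaledWeight α γ A B t u := by
  have : 0 ≤ A + B * heaviside (u - 1) := by unfold heaviside; split_ifs <;> simpa
  unfold scaledWeight
  positivity

theorem abs_add_mul_heaviside_le (x : ℝ) : |A + B * heaviside x| ≤ |A| + |B| := by
  refine (abs_add_le _ _).trans ?_
  unfold heaviside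
  split_ifs <;> simp

theorem hasDerivAt_abs_sub_one_rpow (γ : ℝ) {u : ℝ} (hu : u ≠ 1) :
    HasDerivAt (fun x => |x - 1| ^ γ) (|u - 1| ^ γ * (γ / (u - 1))) u := by
  rcases lt_or_gt_of_ne hu with h | h
  · have h1 : HasDerivAt (fun x : ℝ => (1 - x) ^ γ) (-1 * γ * (1 - u) ^ (γ - 1)) u :=
      ((hasDerivAt_id u).const_sub 1).rpow_const (Or.inl (by simp; linarith))
    have h2 : (fun x : ℝ => |x - 1| ^ γ) =ᶠ[𝓝 u] fun x => (1 - x) ^ γ := by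
      filter_upwards [Iio_mem_nhds h] with x hx
      rw [abs_sub_comm, abs_of_pos (sub_pos.2 hx)]
    refine (h1.congr_of_eventuallyEq h2).congr_deriv ?_
    have h3 : 0 < 1 - u := by linarith
    have h4 : u - 1 ≠ 0 := by linarith
    rw [abs_sub_comm, abs_of_pos h3, Real.rpow_sub_one h3.ne']
    have h5 := h3.ne'
    field_simp
    ring
  · have h3 : 0 < u - 1 := by linarith
    have h1 : HasDerivAt (fun x : ℝ => (x - 1) ^ γ) (1 * γ * (u - 1) ^ (γ - 1)) u :=
      ((hasDerivAt_id u).sub_const 1).rpow_const (Or.inl h3.ne')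
    have h2 : (fun x : ℝ => |x - 1| ^ γ) =ᶠ[𝓝 u] fun x => (x - 1) ^ γ := by
      filter_upwards [Ioi_mem_nhds h] with x hx
      rw [abs_of_pos (sub_pos.2 hx)]
    refine (h1.congr_of_eventuallyEq h2).congr_deriv ?_
    rw [abs_of_pos h3, Real.rpow_sub_one h3.ne']
    ring

/-- The logarithmic derivative of the scaled weight is rational with simple poles. -/
theorem hasDerivAt_scaledWeight {u : ℝ} (hu : 0 < u) (hu1 : u ≠ 1) :
    HasDerivAt (scaledWeight α γ A B t)
      (scaledWeight α γ A B t u * (α / u + γ / (u - 1) - t)) u := by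
  have h1 : HasDerivAt (fun x : ℝ => x ^ α) (u ^ α * (α / u)) u := by
    refine (Real.hasDerivAt_rpow_const (Or.inl hu.ne')).congr_deriv ?_
    rw [Real.rpow_sub_one hu.ne']; ring
  have h2 : HasDerivAt (fun x => A + B * heaviside (x - 1)) 0 u := by
    have : (fun x => A + B * heaviside (x - 1)) =ᶠ[𝓝 u] fun _ => A + B * heaviside (u - 1) := by
      rcases lt_or_gt_of_ne hu1 with h | h
      · filter_upwards [Iio_mem_nhds h] with x (hx : x < 1)
        simp [heaviside, not_lt.2 hx.le, not_lt.2 h.le]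
      · filter_upwards [Ioi_mem_nhds h] with x (hx : 1 < x)
        simp [heaviside, hx, h]
    exact (hasDerivAt_const u _).congr_of_eventuallyEq this
  have h3 : HasDerivAt (fun x => Real.exp (-(t * x))) (Real.exp (-(t * u)) * (-t)) u := by
    have : HasDerivAt (fun x => -(t * x)) (-t) u := by
      simpa using! ((hasDerivAt_id u).const_mul t).neg
    exact this.exp
  refine (((h1.mul (hasDerivAt_abs_sub_one_rpow γ hu1)).mul h2).mul h3).congr_deriv ?_
  unfold scaledWeight
  simp only [Pi.mul_apply]
  ring

theorem integrableOn_mul_div_sub {w : ℝ → ℝ} {c : ℝ} (hc : w c = 0)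
    (h : ∀ p : ℝ[X], IntegrableOn (fun u => p.eval u * w u) (Ioi 0))
    (h1 : IntegrableOn (fun u => w u / (u - c)) (Ioi 0)) (p : ℝ[X]) :
    IntegrableOn (fun u => p.eval u * (w u / (u - c))) (Ioi 0) := by
  obtain ⟨r, hr, -⟩ := exists_eq_C_add_mul p c
  refine ((h1.const_mul (p.eval c)).add (h r)).congr (ae_of_all _ fun u => ?_)
  conv_rhs => rw [hr]
  rcases eq_or_ne u c with rfl | hu
  · simp [hc]
  · have : u - c ≠ 0 := sub_ne_zero.2 hu
    simp only [Pi.add_apply, eval_add, eval_C, eval_mul, eval_sub, eval_X]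
    field_simp

/-- A simple pole may be divided out of an integrable weight vanishing there to a positive
order. -/
theorem integrableOn_div_sub {w : ℝ → ℝ} {c K δ : ℝ} (hc : c ≤ 1) (hδ : 0 < δ)
    (hw : Continuous w) (hI : IntegrableOn w (Ioi 0))
    (hK : ∀ u ∈ Ioc (0 : ℝ) 2, |w u| ≤ K * |u - c| ^ δ) :
    IntegrableOn (fun u => w u / (u - c)) (Ioi 0) := by
  have hm : Measurable fun u => w u / (u - c) := hw.measurable.div (by fun_prop)
  rw [← Ioc_union_Ioi_eq_Ioi (zero_le_two : (0 : ℝ) ≤ 2)]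
  refine IntegrableOn.union ?_ ?_
  · have h1 := (intervalIntegrable_iff_integrableOn_Ioc_of_le zero_le_two).1
      (intervalIntegrable_abs_sub_rpow (r := δ - 1) (by linarith) c 0 2)
    refine Integrable.mono' (h1.const_mul K) hm.aestronglyMeasurable ?_
    refine (ae_restrict_iff' measurableSet_Ioc).2 ?_
    have hne : ∀ᵐ u : ℝ, u ≠ c := by simp [ae_iff]
    filter_upwards [hne] with u hu hu2
    have hpos : 0 < |u - c| := abs_pos.2 (sub_ne_zero.2 hu)
    rw [Real.norm_eq_abs, abs_div, Real.rpow_sub_one hpos.ne', mul_div_assoc']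
    gcongr
    exact hK u hu2
  · have h1 : IntegrableOn w (Ioi 2) := hI.mono_set (Ioi_subset_Ioi zero_le_two)
    refine Integrable.mono' h1.norm hm.aestronglyMeasurable ?_
    refine (ae_restrict_iff' measurableSet_Ioi).2 (ae_of_all _ fun u (hu : 2 < u) => ?_)
    rw [norm_div]
    refine div_le_self (norm_nonneg _) ?_
    rw [Real.norm_eq_abs]
    exact le_trans (by linarith) (le_abs_self (u - c))

theorem abs_scaledWeight_le (ht : 0 < t) {u : ℝ} (hu : 0 < u) :
    |scaledWeight α γ A B t u| ≤ u ^ α * |u - 1| ^ γ * (|A| + |B|) := by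
  unfold scaledWeight
  rw [abs_mul, abs_mul, Real.abs_exp, abs_of_nonneg (by positivity : 0 ≤ u ^ α * |u - 1| ^ γ)]
  have h1 : Real.exp (-(t * u)) ≤ 1 := Real.exp_le_one_iff.2 (by nlinarith)
  have h2 := abs_add_mul_heaviside_le (A := A) (B := B) (u - 1)
  calc _ ≤ u ^ α * |u - 1| ^ γ * (|A| + |B|) * 1 := by gcongr
    _ = _ := mul_one _

theorem integrableOn_scaledWeight_div (hα : 0 < α) (hγ : 0 < γ) (ht : 0 < t) (p : ℝ[X]) :
    IntegrableOn (fun u => p.eval u * (scaledWeight α γ A B t u / (u - 0))) (Ioi 0) := by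
  have hI := integrableOn_scaledWeight (A := A) (B := B) hα hγ ht
  refine integrableOn_mul_div_sub (scaledWeight_zero hα) hI ?_ p
  refine integrableOn_div_sub (K := 1 * (|A| + |B|)) (δ := α) zero_le_one hα
    (continuous_scaledWeight hα hγ) (by simpa using hI 1) fun u hu => ?_
  refine (abs_scaledWeight_le ht hu.1).trans ?_
  have h1 : |u - 1| ^ γ ≤ 1 := Real.rpow_le_one (abs_nonneg _)
    (abs_le.2 ⟨by linarith [hu.1], by linarith [hu.2]⟩) hγ.le
  have h2 : 0 ≤ u ^ α := Real.rpow_nonneg hu.1.le _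
  rw [sub_zero, abs_of_pos hu.1]
  calc _ ≤ u ^ α * 1 * (|A| + |B|) := by gcongr
    _ = _ := by ring

theorem integrableOn_scaledWeight_div_sub_one (hα : 0 < α) (hγ : 0 < γ) (ht : 0 < t) (p : ℝ[X]) :
    IntegrableOn (fun u => p.eval u * (scaledWeight α γ A B t u / (u - 1))) (Ioi 0) := by
  have hI := integrableOn_scaledWeight (A := A) (B := B) hα hγ ht
  refine integrableOn_mul_div_sub (scaledWeight_one hγ) hI ?_ p
  refine integrableOn_div_sub (K := 2 ^ α * (|A| + |B|)) (δ := γ) le_rfl hγ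
    (continuous_scaledWeight hα hγ) (by simpa using hI 1) fun u hu => ?_
  refine (abs_scaledWeight_le ht hu.1).trans ?_
  have h1 : u ^ α ≤ 2 ^ α := Real.rpow_le_rpow hu.1.le hu.2 hα.le
  calc _ ≤ 2 ^ α * |u - 1| ^ γ * (|A| + |B|) := by gcongr
    _ = _ := by ring

/-- The boundary terms vanish at `0`, at infinity, and on both sides of the jump at `1`. -/
theorem integral_deriv_mul_scaledWeight (hα : 0 < α) (hγ : 0 < γ) (ht : 0 < t) (p : ℝ[X]) :
    ∫ u in Ioi (0 : ℝ), ((derivative p).eval u * scaledWeight α γ A B t u +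
      p.eval u * (scaledWeight α γ A B t u * (α / u + γ / (u - 1) - t))) = 0 := by
  set w := scaledWeight α γ A B t with hw
  set F : ℝ → ℝ := fun u => p.eval u * w u with hF
  set F' : ℝ → ℝ := fun u => (derivative p).eval u * w u +
    p.eval u * (w u * (α / u + γ / (u - 1) - t)) with hF'
  have hcont : Continuous F := p.continuous.mul (continuous_scaledWeight hα hγ)
  have hder : ∀ u, 0 < u → u ≠ 1 → HasDerivAt F (F' u) u := fun u hu hu1 =>
    (p.hasDerivAt u).mul (hasDerivAt_scaledWeight hu hu1)
  have hint : IntegrableOn F' (Ioi 0) := by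
    have h1 := integrableOn_scaledWeight (A := A) (B := B) hα hγ ht (derivative p)
    have h2 := (integrableOn_scaledWeight (A := A) (B := B) hα hγ ht p).const_mul t
    have h3 := (integrableOn_scaledWeight_div (A := A) (B := B) hα hγ ht p).const_mul α
    have h4 := (integrableOn_scaledWeight_div_sub_one (A := A) (B := B) hα hγ ht p).const_mul γ
    refine (((h1.add h3).add h4).sub h2).congr (ae_of_all _ fun u => ?_)
    simp only [hF', Pi.add_apply, Pi.sub_apply, ← hw, sub_zero]
    ring
  have hint1 : IntegrableOn F' (Ioi 1) := hint.mono_set (Ioi_subset_Ioi zero_le_one)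
  have hI1 : ∫ u in Ioi (1 : ℝ), F' u = 0 - F 1 := by
    refine integral_Ioi_of_hasDerivAt_of_tendsto hcont.continuousWithinAt
      (fun u (hu : 1 < u) => hder u (by linarith) hu.ne') hint1 ?_
    refine tendsto_zero_of_hasDerivAt_of_integrableOn_Ioi (a := 1)
      (fun u (hu : 1 < u) => hder u (by linarith) hu.ne') hint1 ?_
    exact (integrableOn_scaledWeight hα hγ ht p).mono_set (Ioi_subset_Ioi zero_le_one)
  have hI2 : ∫ u in (0 : ℝ)..1, F' u = F 1 - F 0 := by
    refine intervalIntegral.integral_eq_sub_of_hasDerivAt_of_le zero_le_one hcont.continuousOn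
      (fun u hu => hder u hu.1 hu.2.ne) ?_
    rw [intervalIntegrable_iff_integrableOn_Ioc_of_le zero_le_one]
    exact hint.mono_set Ioc_subset_Ioi_self
  have hF0 : F 0 = 0 := by simp [hF, hw, scaledWeight_zero hα]
  rw [← Ioc_union_Ioi_eq_Ioi (zero_le_one : (0 : ℝ) ≤ 1),
    setIntegral_union (Set.Ioc_disjoint_Ioi le_rfl) measurableSet_Ioi
      (hint.mono_set Ioc_subset_Ioi_self) hint1, hI1,
    ← intervalIntegral.integral_of_le zero_le_one, hI2, hF0]
  ring

/-- The functional `p ↦ ∫₀^∞ p(u) f(u) du` on polynomials. -/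
def integralFunctional (f : ℝ → ℝ)
    (hf : ∀ p : ℝ[X], IntegrableOn (fun u => p.eval u * f u) (Ioi 0)) : ℝ[X] →ₗ[ℝ] ℝ where
  toFun p := ∫ u in Ioi (0 : ℝ), p.eval u * f u
  map_add' p q := by
    rw [← integral_add (hf p) (hf q)]
    simp [add_mul]
  map_smul' c p := by
    rw [RingHom.id_apply, smul_eq_mul, ← integral_const_mul]
    simp [mul_assoc]

theorem integralFunctional_apply {f : ℝ → ℝ}
    (hf : ∀ p : ℝ[X], IntegrableOn (fun u => p.eval u * f u) (Ioi 0)) (p : ℝ[X]) :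
    integralFunctional f hf p = ∫ u in Ioi (0 : ℝ), p.eval u * f u := rfl

theorem pairing_eq_integralFunctional {f : ℝ → ℝ}
    (hf : ∀ p : ℝ[X], IntegrableOn (fun u => p.eval u * f u) (Ioi 0)) (p q : ℝ[X]) :
    pairing f p q = integralFunctional f hf (p * q) := by
  simp [pairing, integralFunctional_apply]

/-- The pole of `M₀` is written `u - 0`, so that both poles have the same shape. -/
theorem semiclassical_integralFunctional (hα : 0 < α) (hγ : 0 < γ) (hA : 0 ≤ A)
    (hAB : 0 ≤ A + B) (h0 : A ≠ 0 ∨ A + B ≠ 0) (ht : 0 < t) :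
    Semiclassical α γ t
      (integralFunctional (scaledWeight α γ A B t) (integrableOn_scaledWeight hα hγ ht))
      (integralFunctional (fun u => scaledWeight α γ A B t u / (u - 0))
        (integrableOn_scaledWeight_div hα hγ ht))
      (integralFunctional (fun u => scaledWeight α γ A B t u / (u - 1))
        (integrableOn_scaledWeight_div_sub_one hα hγ ht)) where
  apply_X_mul p := by
    refine setIntegral_congr_fun measurableSet_Ioi fun u (hu : 0 < u) => ?_
    have := hu.ne'
    simp only [eval_mul, eval_X, sub_zero]
    field_simp
  apply_X_sub_one_mul p := by
    refine setIntegral_congr_fun measurableSet_Ioi fun u _ => ?_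
    rcases eq_or_ne u 1 with rfl | hu
    · simp [scaledWeight_one hγ]
    · have : u - 1 ≠ 0 := sub_ne_zero.2 hu
      simp only [eval_mul, eval_X, eval_sub, eval_one]
      field_simp
  parts p := by
    have h1 := integrableOn_scaledWeight (A := A) (B := B) hα hγ ht (derivative p)
    have h2 := (integrableOn_scaledWeight (A := A) (B := B) hα hγ ht p).const_mul t
    have h3 := (integrableOn_scaledWeight_div (A := A) (B := B) hα hγ ht p).const_mul α
    have h4 := (integrableOn_scaledWeight_div_sub_one (A := A) (B := B) hα hγ ht p).const_mul γ
    simp only [integralFunctional_apply, ← integral_const_mul]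
    rw [← sub_eq_zero, ← integral_add' h1 h3, ← integral_add' (h1.add h3) h4,
      ← integral_sub' ((h1.add h3).add h4) h2]
    refine Eq.trans (integral_congr_ae (ae_of_all _ fun u => ?_))
      (integral_deriv_mul_scaledWeight (A := A) (B := B) hα hγ ht p)
    simp only [Pi.add_apply, Pi.sub_apply, sub_zero]
    ring
  pos p hp := by
    rw [← pairing_eq_integralFunctional]
    exact pairing_scaledWeight_self_pos hα hγ hA hAB h0 ht hp

/-- This strict positivity is what forces `R_n < 1`. -/
theorem integralFunctional_div_pos (hα : 0 < α) (hγ : 0 < γ) (hA : 0 ≤ A)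
    (hAB : 0 ≤ A + B) (h0 : A ≠ 0 ∨ A + B ≠ 0) (ht : 0 < t) {p : ℝ[X]} (hp : p ≠ 0) :
    0 < integralFunctional (fun u => scaledWeight α γ A B t u / (u - 0))
      (integrableOn_scaledWeight_div hα hγ ht) (p * p) := by
  rw [integralFunctional_apply]
  have hnn : ∀ u : ℝ, 0 < u →
      0 ≤ (p * p).eval u * (scaledWeight α γ A B t u / (u - 0)) := fun u hu => by
    have := scaledWeight_nonneg (α := α) (γ := γ) (t := t) hA hAB hu
    rw [eval_mul, sub_zero]
    exact mul_nonneg (mul_self_nonneg _) (div_nonneg this hu.le)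
  refine lt_of_le_of_ne (setIntegral_nonneg measurableSet_Ioi hnn) fun h => ?_
  have h1 := (setIntegral_eq_zero_iff_of_nonneg_ae
    ((ae_restrict_iff' measurableSet_Ioi).2 (ae_of_all _ hnn))
    (integrableOn_scaledWeight_div hα hγ ht (p * p))).1 h.symm
  have h2 : pairing (scaledWeight α γ A B t) p p = 0 := by
    unfold pairing
    refine integral_eq_zero_of_ae ?_
    filter_upwards [h1, ae_restrict_mem measurableSet_Ioi] with u hu (hu0 : 0 < u)
    have hu1 := hu0.ne'
    simp only [eval_mul, sub_zero, Pi.zero_apply] at hu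
    rw [mul_div_assoc', div_eq_zero_iff] at hu
    exact hu.resolve_right hu1
  exact (pairing_scaledWeight_self_pos hα hγ hA hAB h0 ht hp).ne' h2

/-- Differentiation in `t` multiplies by `-u`. -/
theorem hasDerivAt_integral_scaledWeight (hα : 0 < α) (hγ : 0 < γ) (ht : 0 < t) (p : ℝ[X]) :
    HasDerivAt (fun s => ∫ u in Ioi (0 : ℝ), p.eval u * scaledWeight α γ A B s u)
      (-∫ u in Ioi (0 : ℝ), (X * p).eval u * scaledWeight α γ A B t u) t := by
  -- For `s > t / 2` the integrand of the derivative is dominated by its value at `s = t / 2`.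
  have hm : ∀ (q : ℝ[X]) (s : ℝ), AEStronglyMeasurable
      (fun u => q.eval u * scaledWeight α γ A B s u) (volume.restrict (Ioi 0)) := fun q s =>
    (q.continuous.mul (continuous_scaledWeight hα hγ)).aestronglyMeasurable
  have hb := (integrableOn_scaledWeight (A := A) (B := B) hα hγ (half_pos ht) (X * p)).norm
  have key := hasDerivAt_integral_of_dominated_loc_of_deriv_le (𝕜 := ℝ)
    (μ := volume.restrict (Ioi (0 : ℝ)))
    (F := fun s u => p.eval u * scaledWeight α γ A B s u)
    (F' := fun s u => -((X * p).eval u * scaledWeight α γ A B s u))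
    (Ioi_mem_nhds (half_lt_self ht)) (Eventually.of_forall fun s => hm p s)
    (integrableOn_scaledWeight hα hγ ht p) (hm (X * p) t).neg ?_ hb ?_
  · rw [← integral_neg]; exact key.2
  · refine (ae_restrict_iff' measurableSet_Ioi).2 (ae_of_all _ fun u (hu : 0 < u) s hs => ?_)
    have hs' : t / 2 < s := hs
    rw [norm_neg, norm_mul, norm_mul]
    refine mul_le_mul_of_nonneg_left ?_ (norm_nonneg _)
    unfold scaledWeight
    rw [norm_mul, norm_mul _ (Real.exp _)]
    refine mul_le_mul_of_nonneg_left ?_ (norm_nonneg _)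
    rw [Real.norm_eq_abs, Real.norm_eq_abs, Real.abs_exp, Real.abs_exp, Real.exp_le_exp]
    nlinarith
  · refine ae_of_all _ fun u s _ => ?_
    have h1 : HasDerivAt (fun s => Real.exp (-(s * u))) (Real.exp (-(s * u)) * (-u)) s := by
      have : HasDerivAt (fun s => -(s * u)) (-u) s := by
        simpa using! ((hasDerivAt_id s).mul_const u).neg
      exact this.exp
    refine ((h1.const_mul (u ^ α * |u - 1| ^ γ * (A + B * heaviside (u - 1)))).const_mul
      (p.eval u)).congr_deriv ?_
    simp only [scaledWeight, eval_mul, eval_X]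
    ring

end Analysis

/-! ### Polynomials depending on a parameter -/

section Parameter

open Polynomial Filter Topology

/-- The polynomials `p s` have bounded degree and their coefficients are differentiable at `t`,
with derivatives the coefficients of `e`. -/
structure HasCoeffDerivAt (p : ℝ → ℝ[X]) (e : ℝ[X]) (t : ℝ) : Prop where
  bounded : ∃ N, ∀ s, (p s).natDegree ≤ N
  coeff : ∀ k, HasDerivAt (fun s => (p s).coeff k) (e.coeff k) t

namespace HasCoeffDerivAt

variable {p q : ℝ → ℝ[X]} {d e : ℝ[X]} {t : ℝ}

theorem natDegree_le (hp : HasCoeffDerivAt p e t) {N : ℕ} (hN : ∀ s, (p s).natDegree ≤ N) :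
    e.natDegree ≤ N := by
  rw [natDegree_le_iff_coeff_eq_zero]
  intro k hk
  have h1 : (fun s => (p s).coeff k) = fun _ => 0 :=
    funext fun s => coeff_eq_zero_of_natDegree_lt ((hN s).trans_lt hk)
  have h2 := hp.coeff k
  rw [h1] at h2
  exact h2.unique (hasDerivAt_const t 0)

theorem const (p : ℝ[X]) (t : ℝ) : HasCoeffDerivAt (fun _ => p) 0 t :=
  ⟨⟨p.natDegree, fun _ => le_rfl⟩, fun k => by simpa using hasDerivAt_const t (p.coeff k)⟩

theorem C {f : ℝ → ℝ} {f' : ℝ} (hf : HasDerivAt f f' t) :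
    HasCoeffDerivAt (fun s => Polynomial.C (f s)) (Polynomial.C f') t := by
  refine ⟨⟨0, fun s => (natDegree_C _).le⟩, fun k => ?_⟩
  rcases k with _ | k
  · simpa using hf
  · simpa [coeff_C] using hasDerivAt_const t (0 : ℝ)

theorem sub (hp : HasCoeffDerivAt p d t) (hq : HasCoeffDerivAt q e t) :
    HasCoeffDerivAt (fun s => p s - q s) (d - e) t := by
  obtain ⟨M, hM⟩ := hp.bounded
  obtain ⟨N, hN⟩ := hq.bounded
  refine ⟨⟨max M N, fun s => natDegree_sub_le_of_le (hM s) (hN s)⟩, fun k => ?_⟩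
  simpa using! (hp.coeff k).sub (hq.coeff k)

theorem mul (hp : HasCoeffDerivAt p d t) (hq : HasCoeffDerivAt q e t) :
    HasCoeffDerivAt (fun s => p s * q s) (d * q t + p t * e) t := by
  obtain ⟨M, hM⟩ := hp.bounded
  obtain ⟨N, hN⟩ := hq.bounded
  refine ⟨⟨M + N, fun s => natDegree_mul_le_of_le (hM s) (hN s)⟩, fun k => ?_⟩
  simp only [coeff_mul, coeff_add, ← Finset.sum_add_distrib]
  exact HasDerivAt.fun_sum fun x _ => (hp.coeff x.1).mul (hq.coeff x.2)

theorem sum {ι : Type*} (S : Finset ι) {p : ι → ℝ → ℝ[X]} {e : ι → ℝ[X]}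
    (hp : ∀ i ∈ S, HasCoeffDerivAt (p i) (e i) t) :
    HasCoeffDerivAt (fun s => ∑ i ∈ S, p i s) (∑ i ∈ S, e i) t := by
  refine ⟨?_, fun k => ?_⟩
  · choose! N hN using fun i hi => (hp i hi).bounded
    refine ⟨S.sup N, fun s => natDegree_sum_le_of_forall_le _ _ fun i hi => ?_⟩
    exact (hN i hi s).trans (Finset.le_sup hi)
  · simp only [finsetSum_coeff]
    exact HasDerivAt.fun_sum fun i hi => (hp i hi).coeff k

/-- Leibniz rule for a functional whose own derivative is multiplication by `-X`. -/
theorem apply {L : ℝ → ℝ[X] →ₗ[ℝ] ℝ}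
    (hL : ∀ r : ℝ[X], HasDerivAt (fun s => L s r) (-(L t (X * r))) t)
    (hp : HasCoeffDerivAt p e t) :
    HasDerivAt (fun s => L s (p s)) (L t e - L t (X * p t)) t := by
  obtain ⟨N, hN⟩ := hp.bounded
  have hexp : ∀ (s : ℝ) (r : ℝ[X]), r.natDegree ≤ N →
      L s r = ∑ k ∈ Finset.range (N + 1), r.coeff k * L s (X ^ k) := by
    intro s r hr
    conv_lhs => rw [as_sum_range_C_mul_X_pow' r (Nat.lt_succ_of_le hr)]
    rw [map_sum]
    exact Finset.sum_congr rfl fun k _ => C_smul_apply _ _ _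
  have h1 : (fun s => L s (p s)) =
      fun s => ∑ k ∈ Finset.range (N + 1), (p s).coeff k * L s (X ^ k) :=
    funext fun s => hexp s _ (hN s)
  have h2 : L t (X * p t) = ∑ k ∈ Finset.range (N + 1), (p t).coeff k * L t (X * X ^ k) := by
    conv_lhs => rw [as_sum_range_C_mul_X_pow' (p t) (Nat.lt_succ_of_le (hN t)), Finset.mul_sum]
    rw [map_sum]
    refine Finset.sum_congr rfl fun k _ => ?_
    rw [← C_smul_apply]; congr 1; ring
  rw [h1, h2, hexp t e (hp.natDegree_le hN), ← Finset.sum_sub_distrib]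
  refine HasDerivAt.fun_sum fun k _ => ?_
  exact ((hp.coeff k).mul (hL (X ^ k))).congr_deriv (by ring)

end HasCoeffDerivAt

variable {L : ℝ → ℝ[X] →ₗ[ℝ] ℝ} {w : ℝ → ℝ → ℝ} {t : ℝ}

/-- The Gram–Schmidt process preserves differentiability in the parameter. -/
theorem exists_hasCoeffDerivAt_monicOP
    (hL : ∀ r : ℝ[X], HasDerivAt (fun s => L s r) (-(L t (X * r))) t)
    (hw : ∀ᶠ s in 𝓝 t, ∀ p q, pairing (w s) p q = L s (p * q))
    (hpos : ∀ p : ℝ[X], p ≠ 0 → 0 < L t (p * p)) (n : ℕ) :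
    ∃ e, HasCoeffDerivAt (fun s => monicOP (w s) n) e t := by
  induction n using Nat.strong_induction_on with
  | _ n ih =>
    choose! e he using ih
    have key : ∀ k : Fin n, ∃ e', HasCoeffDerivAt (fun s => Polynomial.C
        (pairing (w s) (X ^ n) (monicOP (w s) k) /
          pairing (w s) (monicOP (w s) k) (monicOP (w s) k)) * monicOP (w s) k) e' t := by
      intro k
      have hk := he k k.2
      have h1 := ((HasCoeffDerivAt.const (X ^ n) t).mul hk).apply hL
      have h2 := (hk.mul hk).apply hL
      have h3 := h1.div h2 (hpos _ (monicOP_monic (w t) k).ne_zero).ne'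
      have h4 := h3.congr_of_eventuallyEq (f₁ := fun s =>
        pairing (w s) (X ^ n) (monicOP (w s) k) /
          pairing (w s) (monicOP (w s) k) (monicOP (w s) k)) (by
        filter_upwards [hw] with s hs
        simp only [hs, Pi.div_apply])
      exact ⟨_, (HasCoeffDerivAt.C h4).mul hk⟩
    choose e' he' using key
    refine ⟨0 - ∑ k : Fin n, e' k, ?_⟩
    have := (HasCoeffDerivAt.const (X ^ n) t).sub
      (HasCoeffDerivAt.sum Finset.univ fun k _ => he' k)
    simpa only [← monicOP.eq_1] using this

/-- Differentiating the orthogonality relations in the parameter: the derivative of the monic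
orthogonal polynomial is the last term of the three-term recurrence. -/
theorem isLowerPart_of_hasCoeffDerivAt {Q : ℝ → ℝ[X]} {E : ℝ[X]} {n : ℕ}
    (hL : ∀ r : ℝ[X], HasDerivAt (fun s => L s r) (-(L t (X * r))) t)
    (hQ : ∀ᶠ s in 𝓝 t, IsMonicOrthogonal (L s) n (Q s)) (hE : HasCoeffDerivAt Q E t) :
    IsLowerPart (L t) n (Q t) E := by
  refine ⟨?_, fun q hq => ?_⟩
  · rw [degree_lt_iff_coeff_zero]
    intro k hk
    have h1 : (fun s => (Q s).coeff k) =ᶠ[𝓝 t] fun _ => if k = n then 1 else 0 := by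
      filter_upwards [hQ] with s hs
      split_ifs with h
      · rw [h, hs.coeff_self]
      · exact coeff_eq_zero_of_natDegree_lt (by rw [hs.natDegree_eq]; omega)
    exact (hE.coeff k).unique ((hasDerivAt_const t _).congr_of_eventuallyEq h1)
  · have h1 := (hE.mul (HasCoeffDerivAt.const q t)).apply hL
    have h2 : (fun s => L s (Q s * q)) =ᶠ[𝓝 t] fun _ => 0 := by
      filter_upwards [hQ] with s hs using hs.orthogonal q hq
    have h3 := h1.unique ((hasDerivAt_const t _).congr_of_eventuallyEq h2)
    rw [mul_zero, add_zero, ← mul_assoc] at h3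
    linarith

end Parameter

/-! ### The differential system -/

section System

open Polynomial Filter Topology

variable {α γ A B t : ℝ}

/-- The functional `p ↦ ∫₀^∞ p(u) w(u) du` of the scaled weight `w` for `t > 0`; for `t ≤ 0`, where
the integrals may diverge, it is zero by convention. -/
def scaledFunctional (α γ A B : ℝ) (hα : 0 < α) (hγ : 0 < γ) (t : ℝ) : ℝ[X] →ₗ[ℝ] ℝ :=
  if ht : 0 < t then
    integralFunctional (scaledWeight α γ A B t) (integrableOn_scaledWeight hα hγ ht)
  else 0

theorem scaledFunctional_eq (hα : 0 < α) (hγ : 0 < γ) (ht : 0 < t) :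
    scaledFunctional α γ A B hα hγ t =
      integralFunctional (scaledWeight α γ A B t) (integrableOn_scaledWeight hα hγ ht) :=
  dif_pos ht

theorem pairing_eq_scaledFunctional (hα : 0 < α) (hγ : 0 < γ) (ht : 0 < t) (p q : ℝ[X]) :
    pairing (scaledWeight α γ A B t) p q = scaledFunctional α γ A B hα hγ t (p * q) := by
  rw [scaledFunctional_eq hα hγ ht, pairing_eq_integralFunctional]

theorem hasDerivAt_scaledFunctional (hα : 0 < α) (hγ : 0 < γ) (ht : 0 < t) (p : ℝ[X]) :
    HasDerivAt (fun s => scaledFunctional α γ A B hα hγ s p)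
      (-(scaledFunctional α γ A B hα hγ t (X * p))) t := by
  rw [scaledFunctional_eq hα hγ ht]
  refine (hasDerivAt_integral_scaledWeight hα hγ ht p).congr_of_eventuallyEq ?_
  filter_upwards [Ioi_mem_nhds ht] with s hs
  rw [scaledFunctional_eq hα hγ hs]; rfl

/-- The monic orthogonal polynomials `t ^ (-n) * P_n(t * u, t)` of the scaled weight. -/
def scaledOP (α γ A B : ℝ) (n : ℕ) (t : ℝ) : ℝ[X] := monicOP (scaledWeight α γ A B t) n

theorem P_comp (ht : 0 < t) (n : ℕ) :
    (P α γ A B n t).comp (C t * X) = C (t ^ n) * scaledOP α γ A B n t := by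
  have := Real.rpow_pos_of_pos ht (α + γ)
  exact monicOP_comp (by positivity) ht.ne' (pairing_weight ht) n

theorem isMonicOrthogonal_scaledOP (hα : 0 < α) (hγ : 0 < γ) (hA : 0 ≤ A)
    (hAB : 0 ≤ A + B) (h0 : A ≠ 0 ∨ A + B ≠ 0) (ht : 0 < t) (n : ℕ) :
    IsMonicOrthogonal (scaledFunctional α γ A B hα hγ t) n (scaledOP α γ A B n t) := by
  refine ⟨monicOP_monic _ _, natDegree_monicOP _ _, ?_⟩
  have horth : ∀ k < n, scaledFunctional α γ A B hα hγ t
      (scaledOP α γ A B n t * scaledOP α γ A B k t) = 0 := by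
    intro k hk
    have h1 := pairing_monicOP_of_lt hα hγ hA hAB h0 ht n k hk
    have hP := P_comp (α := α) (γ := γ) (A := A) (B := B) ht
    unfold P at hP
    have hc := Real.rpow_pos_of_pos ht (α + γ)
    rw [pairing_weight ht, hP, hP, pairing_eq_scaledFunctional hα hγ ht,
      show C (t ^ n) * scaledOP α γ A B n t * (C (t ^ k) * scaledOP α γ A B k t) =
        C (t ^ n * t ^ k) * (scaledOP α γ A B n t * scaledOP α γ A B k t) by
        rw [C_mul]; ring, C_smul_apply] at h1
    have h2 : t * t ^ (α + γ) * (t ^ n * t ^ k) ≠ 0 := by positivity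
    rw [← mul_assoc] at h1
    exact (mul_eq_zero.1 h1).resolve_left h2
  -- The polynomials of degree less than `n` are spanned by the preceding ones.
  intro q hq
  induction hd : q.natDegree using Nat.strong_induction_on generalizing q with
  | _ d ih =>
    by_cases hq0 : q = 0
    · simp [hq0]
    have hdn : d < n := by rw [← hd]; exact (natDegree_lt_iff_degree_lt hq0).2 hq
    have hdeg : (scaledOP α γ A B d t).natDegree = d := natDegree_monicOP _ _
    have hcoeff : (scaledOP α γ A B d t).coeff d = 1 := by
      have := (monicOP_monic (scaledWeight α γ A B t) d).coeff_natDegree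
      rwa [natDegree_monicOP] at this
    have hlt : (q - C (q.coeff d) * scaledOP α γ A B d t).degree < d := by
      apply degree_lt_of_coeff_eq_zero
      · exact (natDegree_sub_le_of_le hd.le ((natDegree_C_mul_le _ _).trans hdeg.le)).trans
          (by simp)
      · simp [hcoeff]
    have hr : scaledFunctional α γ A B hα hγ t
        (scaledOP α γ A B n t * (q - C (q.coeff d) * scaledOP α γ A B d t)) = 0 := by
      by_cases hr0 : q - C (q.coeff d) * scaledOP α γ A B d t = 0
      · rw [hr0]; simp
      · exact ih _ ((natDegree_lt_iff_degree_lt hr0).2 hlt) _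
          (hlt.trans (by exact_mod_cast hdn)) rfl
    rw [mul_sub, map_sub, mul_left_comm, C_smul_apply, horth d hdn, mul_zero, sub_zero] at hr
    exact hr

/-- The squared norm of the orthogonal polynomial of the scaled weight. -/
def scaledNorm (α γ A B : ℝ) (hα : 0 < α) (hγ : 0 < γ) (n : ℕ) (t : ℝ) : ℝ :=
  scaledFunctional α γ A B hα hγ t (scaledOP α γ A B n t * scaledOP α γ A B n t)

/-- The functional `p ↦ ∫₀^∞ p(u) w(u) / (u - 1) du` expresses `R_n`. -/
theorem mul_R_eq (hα : 0 < α) (hγ : 0 < γ) (ht : 0 < t) (n : ℕ) :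
    t * R α γ A B n t = γ * integralFunctional (fun u => scaledWeight α γ A B t u / (u - 1))
      (integrableOn_scaledWeight_div_sub_one hα hγ ht)
        (scaledOP α γ A B n t * scaledOP α γ A B n t) / scaledNorm α γ A B hα hγ n t := by
  have hc := (Real.rpow_pos_of_pos ht (α + γ)).ne'
  have hn : t ^ n ≠ 0 := pow_ne_zero _ ht.ne'
  have ht' := ht.ne'
  have hev : ∀ u, (P α γ A B n t).eval (t * u) = t ^ n * (scaledOP α γ A B n t).eval u := by
    intro u
    rw [← eval_comp_C_mul_X, P_comp ht, eval_mul, eval_C]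
  have h1 : h α γ A B n t = t * t ^ (α + γ) * ((t ^ n * t ^ n) *
      scaledNorm α γ A B hα hγ n t) := by
    have : h α γ A B n t = pairing (weight α γ A B t) (P α γ A B n t) (P α γ A B n t) := by
      simp only [h, pairing, sq]
    rw [this, pairing_weight ht, P_comp ht, pairing_eq_scaledFunctional hα hγ ht,
      show C (t ^ n) * scaledOP α γ A B n t * (C (t ^ n) * scaledOP α γ A B n t) =
        C (t ^ n * t ^ n) * (scaledOP α γ A B n t * scaledOP α γ A B n t) by
        rw [C_mul]; ring, C_smul_apply, ← scaledNorm]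
  have h2 : ∫ y in Ioi (0 : ℝ), (P α γ A B n t).eval y ^ 2 / (y - t) * weight α γ A B t y =
      t ^ (α + γ) * (t ^ n * t ^ n) *
        integralFunctional (fun u => scaledWeight α γ A B t u / (u - 1))
          (integrableOn_scaledWeight_div_sub_one hα hγ ht)
          (scaledOP α γ A B n t * scaledOP α γ A B n t) := by
    have h := integral_comp_mul_left_Ioi'
      (fun y => (P α γ A B n t).eval y ^ 2 / (y - t) * weight α γ A B t y) 0 ht
    rw [mul_zero] at h
    rw [← h, smul_eq_mul, integralFunctional_apply, ← integral_const_mul t,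
      ← integral_const_mul (t ^ (α + γ) * (t ^ n * t ^ n))]
    refine setIntegral_congr_fun measurableSet_Ioi fun u hu => ?_
    simp only [hev, weight_mul ht hu, eval_mul, show t * u - t = t * (u - 1) by ring]
    rcases eq_or_ne u 1 with rfl | hu1
    · simp
    · have : u - 1 ≠ 0 := sub_ne_zero.2 hu1
      field_simp
  unfold R
  rw [h1, h2]
  field_simp

/-- The derivative in `t` of the orthogonal polynomial of the scaled weight. -/
theorem exists_derivative_scaledOP (hα : 0 < α) (hγ : 0 < γ) (hA : 0 ≤ A)
    (hAB : 0 ≤ A + B) (h0 : A ≠ 0 ∨ A + B ≠ 0) (ht : 0 < t) (n : ℕ) :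
    ∃ E, HasCoeffDerivAt (scaledOP α γ A B n) E t ∧
      IsLowerPart (scaledFunctional α γ A B hα hγ t) n (scaledOP α γ A B n t) E := by
  have hL := hasDerivAt_scaledFunctional (A := A) (B := B) hα hγ ht
  obtain ⟨E, hE⟩ := exists_hasCoeffDerivAt_monicOP (w := scaledWeight α γ A B) hL (by
      filter_upwards [Ioi_mem_nhds ht] with s hs using pairing_eq_scaledFunctional hα hγ hs)
    (fun p hp => by
      rw [← pairing_eq_scaledFunctional hα hγ ht]
      exact pairing_scaledWeight_self_pos hα hγ hA hAB h0 ht hp) n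
  refine ⟨E, hE, isLowerPart_of_hasCoeffDerivAt (Q := scaledOP α γ A B n) hL ?_ hE⟩
  filter_upwards [Ioi_mem_nhds ht] with s hs
  exact isMonicOrthogonal_scaledOP hα hγ hA hAB h0 hs n

/-- The diagonal coefficient `a_n` of the three-term recurrence
`u Q_n = Q_{n+1} + a_n Q_n + b_n Q_{n-1}` of the scaled weight. -/
def recurrenceA (α γ A B : ℝ) (hα : 0 < α) (hγ : 0 < γ) (n : ℕ) (t : ℝ) : ℝ :=
  scaledFunctional α γ A B hα hγ t (X * scaledOP α γ A B n t * scaledOP α γ A B n t) /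
    scaledNorm α γ A B hα hγ n t

/-- The off-diagonal coefficient `b_n` of the three-term recurrence, with `b_0 = 0`. -/
def recurrenceB (α γ A B : ℝ) (hα : 0 < α) (hγ : 0 < γ) : ℕ → ℝ → ℝ
  | 0, _ => 0
  | n + 1, t => scaledNorm α γ A B hα hγ (n + 1) t / scaledNorm α γ A B hα hγ n t

/-- The coefficient of `u ^ (n - 1)` in the orthogonal polynomial of the scaled weight. -/
def subleadingCoeff (α γ A B : ℝ) (n : ℕ) (t : ℝ) : ℝ := (X * scaledOP α γ A B n t).coeff n

theorem semiclassical_scaledFunctional (hα : 0 < α) (hγ : 0 < γ) (hA : 0 ≤ A)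
    (hAB : 0 ≤ A + B) (h0 : A ≠ 0 ∨ A + B ≠ 0) (ht : 0 < t) :
    Semiclassical α γ t (scaledFunctional α γ A B hα hγ t)
      (integralFunctional (fun u => scaledWeight α γ A B t u / (u - 0))
        (integrableOn_scaledWeight_div hα hγ ht))
      (integralFunctional (fun u => scaledWeight α γ A B t u / (u - 1))
        (integrableOn_scaledWeight_div_sub_one hα hγ ht)) := by
  rw [scaledFunctional_eq hα hγ ht]
  exact semiclassical_integralFunctional hα hγ hA hAB h0 ht

theorem scaledNorm_pos (hα : 0 < α) (hγ : 0 < γ) (hA : 0 ≤ A)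
    (hAB : 0 ≤ A + B) (h0 : A ≠ 0 ∨ A + B ≠ 0) (ht : 0 < t) (n : ℕ) :
    0 < scaledNorm α γ A B hα hγ n t :=
  (semiclassical_scaledFunctional hα hγ hA hAB h0 ht).pos _
    (isMonicOrthogonal_scaledOP hα hγ hA hAB h0 ht n).monic.ne_zero

/-- `R_n` is, up to an explicit term, the diagonal recurrence coefficient.  This is the source of its
differentiability. -/
theorem R_eq (hα : 0 < α) (hγ : 0 < γ) (hA : 0 ≤ A)
    (hAB : 0 ≤ A + B) (h0 : A ≠ 0 ∨ A + B ≠ 0) (ht : 0 < t) (n : ℕ) :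
    R α γ A B n t = recurrenceA α γ A B hα hγ n t - (2 * n + 1 + α + γ) / t := by
  have hN := (scaledNorm_pos hα hγ hA hAB h0 ht n).ne'
  have h1 := (semiclassical_scaledFunctional hα hγ hA hAB h0 ht).parts_X_mul_sq
    (isMonicOrthogonal_scaledOP hα hγ hA hAB h0 ht n)
  have h2 := mul_R_eq (A := A) (B := B) hα hγ ht n
  have ht' := ht.ne'
  rw [eq_div_iff hN] at h2
  rw [← scaledNorm] at h1
  unfold recurrenceA
  field_simp
  linarith

theorem hasDerivAt_scaledNorm (hα : 0 < α) (hγ : 0 < γ) (hA : 0 ≤ A)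
    (hAB : 0 ≤ A + B) (h0 : A ≠ 0 ∨ A + B ≠ 0) (ht : 0 < t) (n : ℕ) :
    HasDerivAt (scaledNorm α γ A B hα hγ n)
      (-(recurrenceA α γ A B hα hγ n t * scaledNorm α γ A B hα hγ n t)) t := by
  obtain ⟨E, hE, hl⟩ := exists_derivative_scaledOP hα hγ hA hAB h0 ht n
  have hQ := isMonicOrthogonal_scaledOP hα hγ hA hAB h0 ht n
  refine ((hE.mul hE).apply (hasDerivAt_scaledFunctional (A := A) (B := B) hα hγ ht)).congr_deriv ?_
  rw [recurrenceA, div_mul_cancel₀ _ (scaledNorm_pos hα hγ hA hAB h0 ht n).ne', map_add,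
    mul_comm E, hQ.orthogonal _ hl.degree_lt, mul_assoc]
  ring

theorem recurrenceB_eq_coeff (hα : 0 < α) (hγ : 0 < γ) (hA : 0 ≤ A)
    (hAB : 0 ≤ A + B) (h0 : A ≠ 0 ∨ A + B ≠ 0) (ht : 0 < t) {n : ℕ} {E : ℝ[X]}
    (hE : IsLowerPart (scaledFunctional α γ A B hα hγ t) n (scaledOP α γ A B n t) E) :
    recurrenceB α γ A B hα hγ n t = (X * E).coeff n := by
  have hQ := isMonicOrthogonal_scaledOP hα hγ hA hAB h0 ht
  rcases n with _ | m
  · simp [recurrenceB]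
  · rw [hE.eq_C_mul (semiclassical_scaledFunctional hα hγ hA hAB h0 ht).pos (hQ (m + 1)) (hQ m),
      coeff_X_mul, coeff_C_mul, (hQ m).coeff_self, mul_one]
    rfl

theorem hasDerivAt_subleadingCoeff (hα : 0 < α) (hγ : 0 < γ) (hA : 0 ≤ A)
    (hAB : 0 ≤ A + B) (h0 : A ≠ 0 ∨ A + B ≠ 0) (ht : 0 < t) (n : ℕ) :
    HasDerivAt (subleadingCoeff α γ A B n) (recurrenceB α γ A B hα hγ n t) t := by
  obtain ⟨E, hE, hl⟩ := exists_derivative_scaledOP hα hγ hA hAB h0 ht n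
  rw [recurrenceB_eq_coeff hα hγ hA hAB h0 ht hl]
  simpa using! ((HasCoeffDerivAt.const X t).mul hE).coeff n

/-- One of the Toda equations. -/
theorem hasDerivAt_recurrenceB_succ (hα : 0 < α) (hγ : 0 < γ) (hA : 0 ≤ A)
    (hAB : 0 ≤ A + B) (h0 : A ≠ 0 ∨ A + B ≠ 0) (ht : 0 < t) (n : ℕ) :
    HasDerivAt (recurrenceB α γ A B hα hγ (n + 1)) (recurrenceB α γ A B hα hγ (n + 1) t *
      (recurrenceA α γ A B hα hγ n t - recurrenceA α γ A B hα hγ (n + 1) t)) t := by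
  have hN := (scaledNorm_pos hα hγ hA hAB h0 ht n).ne'
  refine ((hasDerivAt_scaledNorm hα hγ hA hAB h0 ht (n + 1)).div
    (hasDerivAt_scaledNorm hα hγ hA hAB h0 ht n) hN).congr_deriv ?_
  unfold recurrenceB
  field_simp
  ring

/-- The first equation of the system.  Here `t b_n + p_n`, with `p_n` the subleading coefficient,
is the residue at `1` of the second ladder operator coefficient. -/
theorem hasDerivAt_R (hα : 0 < α) (hγ : 0 < γ) (hA : 0 ≤ A)
    (hAB : 0 ≤ A + B) (h0 : A ≠ 0 ∨ A + B ≠ 0) (ht : 0 < t) (n : ℕ) :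
    HasDerivAt (R α γ A B n) ((t * R α γ A B n t ^ 2
      + (2 * n + 1 + α + γ - t) * R α γ A B n t - γ
      + 2 * (t * recurrenceB α γ A B hα hγ n t + subleadingCoeff α γ A B n t)
      - R α γ A B n t) / t) t := by
  obtain ⟨E, hE, hl⟩ := exists_derivative_scaledOP hα hγ hA hAB h0 ht n
  have hQ := isMonicOrthogonal_scaledOP hα hγ hA hAB h0 ht n
  have hN := (scaledNorm_pos hα hγ hA hAB h0 ht n).ne'
  have ht' := ht.ne'
  have hb := recurrenceB_eq_coeff hα hγ hA hAB h0 ht hl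
  have d1 := (((HasCoeffDerivAt.const X t).mul hE).mul hE).apply
    (hasDerivAt_scaledFunctional (A := A) (B := B) hα hγ ht)
  have d2 := d1.div (hasDerivAt_scaledNorm hα hγ hA hAB h0 ht n) hN
  have d3 := d2.sub ((hasDerivAt_const t (2 * (n : ℝ) + 1 + α + γ)).div (hasDerivAt_id t) ht')
  have e1 : R α γ A B n =ᶠ[𝓝 t] fun s =>
      recurrenceA α γ A B hα hγ n s - (2 * n + 1 + α + γ) / s := by
    filter_upwards [Ioi_mem_nhds ht] with s hs using R_eq hα hγ hA hAB h0 hs n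
  refine (d3.congr_of_eventuallyEq e1).congr_deriv ?_
  have hp := (semiclassical_scaledFunctional hα hγ hA hAB h0 ht).parts_X_mul_X_sub_one_mul_sq hQ
  have hl2 := hl.apply_X_mul hQ
  rw [← hb, ← scaledNorm] at hl2
  rw [R_eq hα hγ hA hAB h0 ht n]
  rw [show (0 * scaledOP α γ A B n t + X * E) * scaledOP α γ A B n t +
      X * scaledOP α γ A B n t * E = X * scaledOP α γ A B n t * E + X * scaledOP α γ A B n t * E
      by ring, map_add, hl2,
    show X * (X * scaledOP α γ A B n t * scaledOP α γ A B n t) =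
      X ^ 2 * (scaledOP α γ A B n t * scaledOP α γ A B n t) by ring]
  have ha : scaledFunctional α γ A B hα hγ t
      (X * scaledOP α γ A B n t * scaledOP α γ A B n t) =
      recurrenceA α γ A B hα hγ n t * scaledNorm α γ A B hα hγ n t := by
    rw [recurrenceA, div_mul_cancel₀ _ hN]
  rw [ha, ← scaledNorm, ← subleadingCoeff] at hp
  rw [ha, eq_div_of_mul_eq ht' ((mul_comm _ _).trans hp), id]
  field_simp
  ring

/-- The second equation of the system, with the two quadratic relations. -/
theorem exists_quadratic_relations (hα : 0 < α) (hγ : 0 < γ) (hA : 0 ≤ A)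
    (hAB : 0 ≤ A + B) (h0 : A ≠ 0 ∨ A + B ≠ 0) (ht : 0 < t) (n : ℕ) (x : ℝ → ℝ)
    (hx : x = fun s => s * recurrenceB α γ A B hα hγ n s + subleadingCoeff α γ A B n s) :
    ∃ z, HasDerivAt x (z - recurrenceB α γ A B hα hγ n t * (t * R α γ A B n t)) t ∧
      x t ^ 2 - γ * x t = t * R α γ A B n t * z ∧
      (x t + n) * (x t + n + α) =
        (t - t * R α γ A B n t) * (t * recurrenceB α γ A B hα hγ n t - z) := by
  obtain ⟨E, hE, hl⟩ := exists_derivative_scaledOP hα hγ hA hAB h0 ht n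
  have hQ := isMonicOrthogonal_scaledOP hα hγ hA hAB h0 ht
  have hS := semiclassical_scaledFunctional hα hγ hA hAB h0 ht
  have hN := (scaledNorm_pos hα hγ hA hAB h0 ht n).ne'
  have hb := recurrenceB_eq_coeff hα hγ hA hAB h0 ht hl
  have hR := mul_R_eq (A := A) (B := B) hα hγ ht
  obtain ⟨q1, q2⟩ := hS.quadratic_relations (hQ n) hl (hR n) (x := x t) (by
    have := hS.parts_X_mul_lower (hQ n) hl
    rw [← hb, ← scaledNorm, ← subleadingCoeff] at this
    rw [← scaledNorm, eq_div_iff hN, hx]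
    linarith) rfl
  refine ⟨_, ?_, q1, by rw [hb]; exact q2⟩
  have dp := hasDerivAt_subleadingCoeff hα hγ hA hAB h0 ht n
  rw [hx]
  -- For `n = m + 1` the lower part is `b_n Q_m`, so that `z = b_n t R_m`, and the Toda equation for
  -- `b_n` applies.  For `n = 0` everything vanishes.
  rcases n with _ | m
  · rw [hl.eq_zero]
    simpa [recurrenceB] using dp
  · have db := hasDerivAt_recurrenceB_succ hα hγ hA hAB h0 ht m
    refine (((hasDerivAt_id t).mul db).add dp).congr_deriv ?_
    have hN' := (scaledNorm_pos hα hγ hA hAB h0 ht m).ne'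
    have ht' := ht.ne'
    have hRm := hR m
    rw [R_eq hα hγ hA hAB h0 ht m, mul_sub, mul_div_cancel₀ _ ht', eq_div_iff hN'] at hRm
    have hB : recurrenceB α γ A B hα hγ (m + 1) t * scaledNorm α γ A B hα hγ m t =
      scaledNorm α γ A B hα hγ (m + 1) t := div_mul_cancel₀ _ hN'
    have hEb : E = C (recurrenceB α γ A B hα hγ (m + 1) t) * scaledOP α γ A B m t :=
      hl.eq_C_mul hS.pos (hQ (m + 1)) (hQ m)
    rw [R_eq hα hγ hA hAB h0 ht (m + 1), hEb, ← scaledNorm,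
      show ∀ (c : ℝ) (q : ℝ[X]), C c * q * (C c * q) = C (c * c) * (q * q) from fun c q => by
        rw [C_mul]; ring, C_smul_apply]
    have hz : γ * (recurrenceB α γ A B hα hγ (m + 1) t * recurrenceB α γ A B hα hγ (m + 1) t *
        integralFunctional (fun u => scaledWeight α γ A B t u / (u - 1))
          (integrableOn_scaledWeight_div_sub_one hα hγ ht)
          (scaledOP α γ A B m t * scaledOP α γ A B m t)) / scaledNorm α γ A B hα hγ (m + 1) t =
        recurrenceB α γ A B hα hγ (m + 1) t *
          (t * recurrenceA α γ A B hα hγ m t - (2 * m + 1 + α + γ)) := by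
      rw [div_eq_iff hN, ← hB, mul_left_comm γ, ← hRm]
      ring
    rw [hz, id, mul_sub t, mul_div_cancel₀ _ ht']
    push_cast
    ring

/-- The residues `t R_n` and `t (1 - R_n)` sum to `t`, and the one at `0` is positive. -/
theorem R_lt_one (hα : 0 < α) (hγ : 0 < γ) (hA : 0 ≤ A)
    (hAB : 0 ≤ A + B) (h0 : A ≠ 0 ∨ A + B ≠ 0) (ht : 0 < t) (n : ℕ) : R α γ A B n t < 1 := by
  have hQ := isMonicOrthogonal_scaledOP hα hγ hA hAB h0 ht n
  have hN := scaledNorm_pos hα hγ hA hAB h0 ht n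
  have h1 := (semiclassical_scaledFunctional hα hγ hA hAB h0 ht).parts_sq hQ
  have h2 := integralFunctional_div_pos hα hγ hA hAB h0 ht hQ.monic.ne_zero
  have h3 := mul_R_eq (A := A) (B := B) hα hγ ht n
  rw [eq_div_iff hN.ne'] at h3
  have h4 := mul_pos hα h2
  rw [← h3, ← scaledNorm] at h1
  have h5 : 0 < (t * scaledNorm α γ A B hα hγ n t) * (1 - R α γ A B n t) := by linarith
  linarith [(mul_pos_iff_of_pos_left (by positivity)).1 h5]

end System

/-! ### From the system to the fifth Painlevé equation -/

section Painleve

open Filter Topology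

/-- Elimination of `x` from the system: it is expressed through `R` and `R'` by the first
equation. -/
theorem ode_of_system {α γ n t r r₁ r₂ x x₁ b z : ℝ}
    (h1 : t * r₁ = t * r ^ 2 + (2 * n + 1 + α + γ - t) * r - γ + 2 * x - r)
    (h2 : t * r₂ = r ^ 2 + 2 * t * r * r₁ + (2 * n + 1 + α + γ - t) * r₁ - r + 2 * x₁ - 2 * r₁)
    (h3 : x₁ = z - b * (t * r)) (h4 : x ^ 2 - γ * x = t * r * z)
    (h5 : (x + n) * (x + n + α) = (t - t * r) * (t * b - z)) :
    2 * t ^ 2 * r * (1 - r) * r₂ - t ^ 2 * (1 - 2 * r) * r₁ ^ 2 + 2 * t * r * (1 - r) * r₁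
      + 2 * t ^ 2 * r ^ 5 + t * (4 * n + 2 + 2 * α + 2 * γ - 5 * t) * r ^ 4
      - 4 * t * (2 * n + 1 + α + γ - t) * r ^ 3
      - (t ^ 2 - 2 * (2 * n + 1 + α + γ) * t + α ^ 2 - γ ^ 2) * r ^ 2
      - 2 * γ ^ 2 * r + γ ^ 2 = 0 := by
  have hx : x = (t * r₁ - t * r ^ 2 - (2 * n + 1 + α + γ - t) * r + γ + r) / 2 := by linarith
  -- Multiplying by `r (1 - r)` makes `b` and `z` disappear by means of the quadratic relations.
  have h6 : t * r * (1 - r) * x₁ =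
      (1 - r) ^ 2 * (x ^ 2 - γ * x) - r ^ 2 * ((x + n) * (x + n + α)) := by
    rw [h3, h4, h5]; ring
  rw [hx] at h6
  linear_combination 2 * t * r * (1 - r) * h2 + 4 * h6

/-- The Möbius transformation `S = R / (R - 1)` carries the equation for `R` to Painlevé V. -/
theorem painleve_of_ode {α γ n t r r₁ r₂ s s₁ s₂ : ℝ} (ht : t ≠ 0) (hr : r ≠ 0) (hr1 : r - 1 ≠ 0)
    (hs : s = r / (r - 1)) (hs₁ : s₁ = -r₁ / (r - 1) ^ 2)
    (hs₂ : s₂ = -r₂ / (r - 1) ^ 2 + 2 * r₁ ^ 2 / (r - 1) ^ 3)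
    (h : 2 * t ^ 2 * r * (1 - r) * r₂ - t ^ 2 * (1 - 2 * r) * r₁ ^ 2 + 2 * t * r * (1 - r) * r₁
      + 2 * t ^ 2 * r ^ 5 + t * (4 * n + 2 + 2 * α + 2 * γ - 5 * t) * r ^ 4
      - 4 * t * (2 * n + 1 + α + γ - t) * r ^ 3
      - (t ^ 2 - 2 * (2 * n + 1 + α + γ) * t + α ^ 2 - γ ^ 2) * r ^ 2
      - 2 * γ ^ 2 * r + γ ^ 2 = 0) :
    s₂ = (3 * s - 1) * s₁ ^ 2 / (2 * s * (s - 1)) - s₁ / t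
      + (s - 1) ^ 2 / t ^ 2 * (α ^ 2 * s / 2 - γ ^ 2 / (2 * s))
      - (2 * n + 1 + α + γ) * s / t - s * (s + 1) / (2 * (s - 1)) := by
  have e1 : s - 1 = 1 / (r - 1) := by rw [hs]; field_simp; ring
  have e2 : s + 1 = (2 * r - 1) / (r - 1) := by rw [hs]; field_simp; ring
  have e3 : 3 * s - 1 = (2 * r + 1) / (r - 1) := by rw [hs]; field_simp; ring
  rw [e1, e2, e3, hs, hs₁, hs₂]
  field_simp
  linear_combination h

theorem hasDerivAt_div_sub_one {f : ℝ → ℝ} {f' t : ℝ} (hf : HasDerivAt f f' t) (h1 : f t - 1 ≠ 0) :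
    HasDerivAt (fun s => f s / (f s - 1)) (-f' / (f t - 1) ^ 2) t :=
  (hf.div (hf.sub_const 1) h1).congr_deriv (by ring)

end Painleve

end PerturbedLaguerre

end

theorem mainTheorem2 (α γ A B : ℝ) (hα : 0 < α) (hγ : 0 < γ) (hA : 0 ≤ A) (hAB : 0 ≤ A + B)
    (h0 : A ≠ 0 ∨ A + B ≠ 0) (n : ℕ) (R S : ℝ → ℝ)
    (hR : R = PerturbedLaguerre.R α γ A B n) (hS : S = PerturbedLaguerre.S α γ A B n) :
    ∀ t : ℝ, 0 < t →
      (DifferentiableAt ℝ R t ∧ DifferentiableAt ℝ (deriv R) t ∧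
        2 * t ^ 2 * R t * (1 - R t) * deriv (deriv R) t
          - t ^ 2 * (1 - 2 * R t) * (deriv R t) ^ 2
          + 2 * t * R t * (1 - R t) * deriv R t
          + 2 * t ^ 2 * R t ^ 5
          + t * (4 * n + 2 + 2 * α + 2 * γ - 5 * t) * R t ^ 4
          - 4 * t * (2 * n + 1 + α + γ - t) * R t ^ 3
          - (t ^ 2 - 2 * (2 * n + 1 + α + γ) * t + α ^ 2 - γ ^ 2) * R t ^ 2
          - 2 * γ ^ 2 * R t + γ ^ 2 = 0) ∧
      R t ≠ 1 ∧ DifferentiableAt ℝ S t ∧ DifferentiableAt ℝ (deriv S) t ∧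
      (R t ≠ 0 →
        deriv (deriv S) t =
            (3 * S t - 1) * (deriv S t) ^ 2 / (2 * S t * (S t - 1)) - deriv S t / t
              + (S t - 1) ^ 2 / t ^ 2 * (α ^ 2 * S t / 2 - γ ^ 2 / (2 * S t))
              - (2 * n + 1 + α + γ) * S t / t - S t * (S t + 1) / (2 * (S t - 1)) ∧
        PerturbedLaguerre.PainleveVAt (α ^ 2 / 2) (-(γ ^ 2) / 2) (-(2 * n + 1 + α + γ)) (-1 / 2)
          S t) := by
  subst hR hS
  intro t ht
  set R := PerturbedLaguerre.R α γ A B n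
  set b := PerturbedLaguerre.recurrenceB α γ A B hα hγ n
  set x : ℝ → ℝ := fun s => s * b s + PerturbedLaguerre.subleadingCoeff α γ A B n s with hx
  set ρ : ℝ → ℝ := fun s =>
    (s * R s ^ 2 + (2 * n + 1 + α + γ - s) * R s - γ + 2 * x s - R s) / s with hρ
  have hR : ∀ s, 0 < s → HasDerivAt R (ρ s) s := fun s hs =>
    PerturbedLaguerre.hasDerivAt_R hα hγ hA hAB h0 hs n
  have hlt : ∀ s, 0 < s → R s < 1 := fun s hs =>
    PerturbedLaguerre.R_lt_one hα hγ hA hAB h0 hs n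
  obtain ⟨z, hx', q1, q2⟩ :=
    PerturbedLaguerre.exists_quadratic_relations hα hγ hA hAB h0 ht n x hx
  have hev : ∀ᶠ s in nhds t, 0 < s := Ioi_mem_nhds ht
  have ht' := ht.ne'
  have hne : ∀ s, 0 < s → R s - 1 ≠ 0 := fun s hs => (sub_neg.2 (hlt s hs)).ne
  have hdR : deriv R =ᶠ[nhds t] ρ := by
    filter_upwards [hev] with s hs using (hR s hs).deriv
  have hRt := hR t ht
  obtain ⟨r₂, hr₂, hρ'⟩ : ∃ r₂, t * r₂ = R t ^ 2 + 2 * t * R t * ρ t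
      + (2 * n + 1 + α + γ - t) * ρ t - R t
      + 2 * (z - b t * (t * R t)) - 2 * ρ t ∧ HasDerivAt ρ r₂ t := by
    refine ⟨_, ?_, ((((((hasDerivAt_id t).mul (hRt.pow 2)).add
      (((hasDerivAt_id t).const_sub (2 * (n : ℝ) + 1 + α + γ)).mul hRt)).sub_const γ).add
      (hx'.const_mul 2)).sub hRt).div (hasDerivAt_id t) ht'⟩
    simp [hρ]
    field_simp
    ring
  -- The first equation gives `R' = ρ` near `t`, and the second one makes `ρ` differentiable.
  have hd2 : HasDerivAt (deriv R) r₂ t := hρ'.congr_of_eventuallyEq hdR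
  have hode := PerturbedLaguerre.ode_of_system (n := n) (b := b t) (z := z) (r₁ := ρ t)
    (by simp only [hρ]; field_simp) hr₂ rfl q1 q2
  have hS : ∀ s, 0 < s → HasDerivAt (PerturbedLaguerre.S α γ A B n)
      (-ρ s / (R s - 1) ^ 2) s := fun s hs =>
    PerturbedLaguerre.hasDerivAt_div_sub_one (hR s hs) (hne s hs)
  have hdS : deriv (PerturbedLaguerre.S α γ A B n) =ᶠ[nhds t]
      fun s => -ρ s / (R s - 1) ^ 2 := by
    filter_upwards [hev] with s hs using (hS s hs).deriv
  have hd2S : HasDerivAt (deriv (PerturbedLaguerre.S α γ A B n))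
      (-r₂ / (R t - 1) ^ 2 + 2 * ρ t ^ 2 / (R t - 1) ^ 3) t := by
    refine ((hρ'.neg.div ((hRt.sub_const 1).pow 2)
      (pow_ne_zero 2 (hne t ht))).congr_of_eventuallyEq hdS).congr_deriv ?_
    have := hne t ht
    simp
    field_simp
  refine ⟨⟨hRt.differentiableAt, hd2.differentiableAt, ?_⟩, (hlt t ht).ne,
    (hS t ht).differentiableAt, hd2S.differentiableAt, fun hr => ?_⟩
  · rw [hd2.deriv, hRt.deriv]
    exact hode
  have hp := PerturbedLaguerre.painleve_of_ode ht' hr (hne t ht)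
    (s := PerturbedLaguerre.S α γ A B n t) rfl (hS t ht).deriv hd2S.deriv hode
  have hS0 : PerturbedLaguerre.S α γ A B n t ≠ 0 := div_ne_zero hr (hne t ht)
  have hS1 : PerturbedLaguerre.S α γ A B n t ≠ 1 := by
    intro h
    have := (div_eq_one_iff_eq (hne t ht)).1 h
    linarith
  refine ⟨hp, ?_, hd2S.differentiableAt, ht', hS0, hS1, hp.trans ?_⟩
  · filter_upwards [hev] with s hs using (hS s hs).differentiableAt
  · have := sub_ne_zero.2 hS1
    field_simp
    ring
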